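/- Let $m, p, s, N$ be positive integers with $m \le p$, $s \le p$ and $p(m-1) \ge 50$, and let $\sigma, \sigma_a > 0$. Write $\|\cdot\|_F$ for the Frobenius norm, $\mathcal{D} \subset \mathbb{R}^{m\times p}$ for the set of matrices (dictionaries) whose columns all have Euclidean norm $1$, and, for $D_0 \in \mathcal{D}$ and $r>0$, $\mathcal{X}(D_0,r) = \{ D \in \mathcal{D} : \|D - D_0\|_F < r\}$. For $D \in \mathcal{D}$ consider the model $y = Dx + n$, where $n \sim \mathcal{N}(0, \sigma^2 I_m)$ is independent of $x$, and $x = P\,(z^T, 0_{1\times(p-s)})^T$ with $P$ a uniformly random $p\times p$ permutation matrix and $z \sim \mathcal{N}(0,\sigma_a^2 I_s)$ independent of $P$ (so $x$ has a uniformly random support of size $s$ and i.i.d. $\mathcal{N}(0,\sigma_a^2)$ nonzero entries). Let $Y = (y_1,\dots,y_N)$ consist of $N$ i.i.d. copies of $y$, and define the minimax risk $$\varepsilon^* = \inf_{\widehat D}\ \sup_{D \in \mathcal{X}(D_0,r)} \mathbb{E}_Y\big\{\|\widehat D(Y) - D\|_F^2\big\},$$ where the infimum is over all (measurable) estimators $\widehat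 D : \mathbb{R}^{m\times N}\to\mathbb{R}^{m\times p}$. Let $\mathrm{SNR} = \mathrm{SNR}(D) = \mathbb{E}\|Dx\|_2^2 / \mathbb{E}\|n\|_2^2$. Theorem. Let $D_0 \in \mathcal{D}$, $0 < r \le 2\sqrt{p}$, and let $D \in \mathcal{X}(D_0,r)$ (for instance $D = D_0$) satisfy the restricted isometry property of order $s$ with a constant $\delta_s \le 1/2$, i.e. $(1-\delta_s)\|z\|_2^2 \le \|Dz\|_2^2 \le (1+\delta_s)\|z\|_2^2$ for every $z\in\mathbb{R}^p$ with at most $s$ nonzero entries. If $\mathrm{SNR} \le \frac{1}{9\sqrt{80}}\cdot\frac{m}{2s}$, then $$\varepsilon^* \ \ge\ \frac{1}{12960}\,\min\left\{ \frac{r^2}{s},\ \frac{p}{\mathrm{SNR}^2\, N\, m^2}\left(\frac{p(m-1)}{10} - 1\right)\right\}.$$ -/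

import Mathlib

open MeasureTheory ProbabilityTheory
open scoped ENNReal Nat Matrix

noncomputable section

namespace DictLearn

/-- Frobenius norm `‖A‖_F = √(Tr (A Aᵀ))`. -/
def frobNorm {m p : ℕ} (A : Matrix (Fin m) (Fin p) ℝ) : ℝ :=
  √((A * Aᵀ).trace)

/-- Euclidean norm of a vector. -/
def euclNorm {n : ℕ} (v : Fin n → ℝ) : ℝ :=
  ‖WithLp.toLp 2 v‖

/-- The dictionaries with normalized columns (oblique manifold). -/
def obliqueManifold (m p : ℕ) : Set (Matrix (Fin m) (Fin p) ℝ) :=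
  {B | ∀ k, (Bᵀ * B) k k = 1}

/-- The dictionaries with normalized columns in the open Frobenius ball around `D₀`. -/
def neighborhood {m p : ℕ} (D₀ : Matrix (Fin m) (Fin p) ℝ) (r : ℝ) :
    Set (Matrix (Fin m) (Fin p) ℝ) :=
  {D | D ∈ obliqueManifold m p ∧ frobNorm (D - D₀) < r}

/-- Restricted isometry property of order `s` with constant `δ`;
`hammingNorm z` is the number of non-zero entries of `z`. -/
def RIP {m p : ℕ} (D : Matrix (Fin m) (Fin p) ℝ) (s : ℕ) (δ : ℝ) : Prop :=
  ∀ z : Fin p → ℝ, hammingNorm z ≤ s →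
    (1 - δ) * euclNorm z ^ 2 ≤ euclNorm (D *ᵥ z) ^ 2 ∧
      euclNorm (D *ᵥ z) ^ 2 ≤ (1 + δ) * euclNorm z ^ 2

/-- Law of a vector in `ℝⁿ` with i.i.d. entries `N(0, τ²)`. -/
def iidGaussian (n : ℕ) (τ : ℝ) : Measure (Fin n → ℝ) :=
  Measure.pi fun _ => gaussianReal 0 (τ ^ 2).toNNReal

/-- The vector `(zᵀ, 0)ᵀ ∈ ℝᵖ` (for `s ≤ p`). -/
def zeroPad (p : ℕ) {s : ℕ} (z : Fin s → ℝ) : Fin p → ℝ :=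
  fun i => if h : (i : ℕ) < s then z ⟨i, h⟩ else 0

/-- Law of the coefficient vector `x = P (zᵀ, 0)ᵀ`, where `P` is a uniformly random `p × p`
permutation matrix, independent of `z ~ N(0, σₐ² I_s)`: the average over all `p !`
permutation matrices of the laws of `P (zᵀ, 0)ᵀ` with `P` fixed. -/
def coeffLaw (p s : ℕ) (σa : ℝ) : Measure (Fin p → ℝ) :=
  (p ! : ℝ≥0∞)⁻¹ • ∑ π : Equiv.Perm (Fin p),
    (iidGaussian s σa).map fun z => π.permMatrix ℝ *ᵥ zeroPad p z

/-- Law of one observation `y = D x + n`, with `x` as in `coeffLaw` and independent white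
Gaussian noise `n ~ N(0, σ² I_m)`. -/
def obsLaw {m p : ℕ} (s : ℕ) (σa σ : ℝ) (D : Matrix (Fin m) (Fin p) ℝ) :
    Measure (Fin m → ℝ) :=
  ((coeffLaw p s σa).prod (iidGaussian m σ)).map fun xn => D *ᵥ xn.1 + xn.2

/-- Law of the data `Y = (y₁, …, y_N)`: `N` i.i.d. observations. -/
def dataLaw {m p : ℕ} (N s : ℕ) (σa σ : ℝ) (D : Matrix (Fin m) (Fin p) ℝ) :
    Measure (Fin N → Fin m → ℝ) :=
  Measure.pi fun _ => obsLaw s σa σ D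

/-- Signal-to-noise ratio `E ‖D x‖² / E ‖n‖²`. -/
def SNR {m p : ℕ} (s : ℕ) (σa σ : ℝ) (D : Matrix (Fin m) (Fin p) ℝ) : ℝ :=
  (∫ x, euclNorm (D *ᵥ x) ^ 2 ∂coeffLaw p s σa) / (∫ n, euclNorm n ^ 2 ∂iidGaussian m σ)

/-- Mean squared error `E_Y ‖D̂(Y) - D‖_F²` of an estimator when `D` is the true dictionary. -/
def mse {m p : ℕ} (N s : ℕ) (σa σ : ℝ)
    (est : (Fin N → Fin m → ℝ) → Matrix (Fin m) (Fin p) ℝ)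
    (D : Matrix (Fin m) (Fin p) ℝ) : ℝ≥0∞ :=
  ∫⁻ Y, ENNReal.ofReal (frobNorm (est Y - D) ^ 2) ∂dataLaw N s σa σ D

/-- Minimax risk: infimum over all (measurable) estimators of the worst-case mean squared
error over `neighborhood D₀ r`, a value in `[0, ∞]`. Measurability is entrywise. -/
def minimaxRisk {m p : ℕ} (N s : ℕ) (σa σ : ℝ) (D₀ : Matrix (Fin m) (Fin p) ℝ) (r : ℝ) :
    ℝ≥0∞ :=
  ⨅ est : {f : (Fin N → Fin m → ℝ) → Matrix (Fin m) (Fin p) ℝ //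
      ∀ i j, Measurable fun Y => f Y i j},
    ⨆ D ∈ neighborhood D₀ r, mse N s σa σ est.1 D

end DictLearn

end

/-! The proof is Assouad's method on a cube of dictionaries. Column `k` of a cube point is `α d_k +
b ∑ⱼ ± u_kj`, where `d_k` is the column of `D₀`, the `u_kj` are an orthonormal basis of its
orthogonal complement, and `α² + (m-1) b² = 1` keeps the column normalized. Each of the `p (m-1)`
signs moves one coordinate of one column by `2b`, and by Bessel the squared coordinate errors add up
to at most the squared Frobenius error. It remains to show that neighbouring cube points, which
differ in a single column, cannot be told apart from the data (`minimaxRisk_ge`).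

For this the observer is given more than `Y`: the permutation, the coefficients of the other
columns, and the part of `y` due to column `k` and the noise. `Y` is a function of these data that
does not involve column `k` (`obsLaw_eq_map_mixture`), so a two point bound for the richer
experiment applies to every estimator based on `Y`. There the two hypotheses are centred Gaussians
with covariances `σ² I + σₐ² d dᵀ` and `σ² I + σₐ² d' d'ᵀ`. Their divergence is at most `(σₐ²/σ²)²
‖d - d'‖² / 2` (`integral_spikeLLR_ge`), and it is incurred only when column `k` is active, which
has probability `s/p`. With `N` samples the total stays below `1/2` when `b` is small enough, so
each sign costs a fixed fraction of `b²`. -/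

namespace DictLearn

/-- `Q` has density `exp ∘ ℓ` with respect to `P`. -/
def HasLogDensity {α : Type*} [MeasurableSpace α] (P Q : Measure α) (ℓ : α → ℝ) : Prop :=
  Measurable ℓ ∧ Q = P.withDensity fun x => ENNReal.ofReal (Real.exp (ℓ x))

/-! ### Log-densities under products and finite mixtures. -/

section LogDensity

variable {α β : Type*} [MeasurableSpace α] [MeasurableSpace β]

theorem HasLogDensity.refl (P : Measure α) : HasLogDensity P P (fun _ => 0) := by
  refine ⟨measurable_const, ?_⟩
  simp

theorem HasLogDensity.measurable_density {P Q : Measure α} {ℓ : α → ℝ}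
    (h : HasLogDensity P Q ℓ) : Measurable fun x => ENNReal.ofReal (Real.exp (ℓ x)) :=
  h.1.exp.ennreal_ofReal

theorem HasLogDensity.of_common {P Q Q' : Measure α} {ℓ ℓ' : α → ℝ}
    (h : HasLogDensity P Q ℓ) (h' : HasLogDensity P Q' ℓ') :
    HasLogDensity Q Q' (fun x => ℓ' x - ℓ x) := by
  have hm : Measurable fun x => ℓ' x - ℓ x := h'.1.sub h.1
  refine ⟨hm, ?_⟩
  rw [h.2, h'.2, ← withDensity_mul _ h.measurable_density hm.exp.ennreal_ofReal]
  congr 1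
  ext x
  simp only [Pi.mul_apply]
  rw [← ENNReal.ofReal_mul (Real.exp_pos _).le, ← Real.exp_add, add_sub_cancel]

theorem HasLogDensity.prod_left (R : Measure β) [SFinite R] {P Q : Measure α} [SFinite P]
    {ℓ : α → ℝ} (h : HasLogDensity P Q ℓ) :
    HasLogDensity (R.prod P) (R.prod Q) (fun x => ℓ x.2) := by
  refine ⟨h.1.comp measurable_snd, ?_⟩
  have := h.2
  subst this
  rw [prod_withDensity_right h.measurable_density]

theorem lintegral_pi_prod {ι : Type*} [Fintype ι] {E : ι → Type*} [∀ i, MeasurableSpace (E i)]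
    (P : ∀ i, Measure (E i)) [∀ i, IsProbabilityMeasure (P i)] {f : ∀ i, E i → ℝ≥0∞}
    (hf : ∀ i, Measurable (f i)) :
    ∫⁻ x, ∏ i, f i (x i) ∂Measure.pi P = ∏ i, ∫⁻ x, f i x ∂P i := by
  have hind : iIndepFun (fun i (x : ∀ i, E i) => f i (x i)) (Measure.pi P) :=
    iIndepFun_pi (X := f) fun i => (hf i).aemeasurable
  have h := lintegral_prod_eq_prod_lintegral_of_indepFun Finset.univ
    (fun i (x : ∀ i, E i) => f i (x i)) hind fun i => (hf i).comp (measurable_pi_apply i)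
  rw [h]
  refine Finset.prod_congr rfl fun i _ => ?_
  exact (measurePreserving_eval P i).lintegral_comp (hf i)

theorem HasLogDensity.pi {ι : Type*} [Fintype ι] {E : ι → Type*} [∀ i, MeasurableSpace (E i)]
    {P Q : ∀ i, Measure (E i)} [∀ i, IsProbabilityMeasure (P i)]
    [∀ i, IsProbabilityMeasure (Q i)] {ℓ : ∀ i, E i → ℝ}
    (h : ∀ i, HasLogDensity (P i) (Q i) (ℓ i)) :
    HasLogDensity (Measure.pi P) (Measure.pi Q) (fun x => ∑ i, ℓ i (x i)) := by
  refine ⟨Finset.measurable_sum _ fun i _ => (h i).1.comp (measurable_pi_apply i), ?_⟩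
  refine Measure.pi_eq fun s hs => ?_
  rw [withDensity_apply _ (MeasurableSet.univ_pi hs),
    ← lintegral_indicator (MeasurableSet.univ_pi hs)]
  have key : ∀ x : ∀ i, E i, (Set.univ.pi s).indicator
      (fun x => ENNReal.ofReal (Real.exp (∑ i, ℓ i (x i)))) x =
      ∏ i, (s i).indicator (fun y => ENNReal.ofReal (Real.exp (ℓ i y))) (x i) := by
    intro x
    by_cases hx : x ∈ Set.univ.pi s
    · rw [Set.indicator_of_mem hx, Real.exp_sum,
        ENNReal.ofReal_prod_of_nonneg fun i _ => (Real.exp_pos _).le]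
      refine Finset.prod_congr rfl fun i _ => ?_
      rw [Set.indicator_of_mem (hx i trivial)]
    · rw [Set.indicator_of_notMem hx]
      simp only [Set.mem_univ_pi, not_forall] at hx
      obtain ⟨i, hi⟩ := hx
      exact (Finset.prod_eq_zero (Finset.mem_univ i) (Set.indicator_of_notMem hi _)).symm
  simp_rw [key]
  rw [lintegral_pi_prod P fun i => (h i).measurable_density.indicator (hs i)]
  refine Finset.prod_congr rfl fun i _ => ?_
  rw [lintegral_indicator (hs i), (h i).2, withDensity_apply _ (hs i)]

/-- The law of a pair `(i, w)`, where `i` has weights `c` on a finite type and `w` has law `P i`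
given `i`. -/
noncomputable def mixture {ι : Type*} [Fintype ι] [MeasurableSpace ι] (c : ℝ≥0∞) (P : ι → Measure α) :
    Measure (ι × α) :=
  c • ∑ i, (P i).map (Prod.mk i)

theorem HasLogDensity.mixture {ι : Type*} [Fintype ι] [MeasurableSpace ι]
    [MeasurableSingletonClass ι] (c : ℝ≥0∞) {P Q : ι → Measure α}
    {ℓ : ι → α → ℝ} (h : ∀ i, HasLogDensity (P i) (Q i) (ℓ i)) :
    HasLogDensity (mixture c P) (mixture c Q) (fun x => ℓ x.1 x.2) := by
  have hm : Measurable fun x : ι × α => ℓ x.1 x.2 :=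
    measurable_from_prod_countable_right fun i => (h i).1
  refine ⟨hm, ?_⟩
  refine Measure.ext_of_lintegral _ fun f hf => ?_
  rw [lintegral_withDensity_eq_lintegral_mul _ hm.exp.ennreal_ofReal hf]
  simp only [DictLearn.mixture, lintegral_smul_measure, lintegral_finsetSum_measure]
  congr 1
  refine Finset.sum_congr rfl fun i _ => ?_
  rw [lintegral_map hf measurable_prodMk_left,
    lintegral_map (hm.exp.ennreal_ofReal.mul hf) measurable_prodMk_left, (h i).2,
    lintegral_withDensity_eq_lintegral_mul _ (h i).measurable_density
      (g := fun a => f (i, a)) (hf.comp measurable_prodMk_left)]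
  rfl

theorem integrable_mixture {ι : Type*} [Fintype ι] [MeasurableSpace ι]
    [MeasurableSingletonClass ι] {c : ℝ≥0∞} (hc : c ≠ ∞) {P : ι → Measure α} {f : ι → α → ℝ}
    (hm : ∀ i, Measurable (f i))
    (hf : ∀ i, Integrable (f i) (P i)) : Integrable (fun x => f x.1 x.2) (mixture c P) := by
  have hm : Measurable fun x : ι × α => f x.1 x.2 := measurable_from_prod_countable_right hm
  refine Integrable.smul_measure (integrable_finsetSum_measure.2 fun i _ => ?_) hc
  rw [integrable_map_measure hm.aestronglyMeasurable measurable_prodMk_left.aemeasurable]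
  exact hf i

theorem integral_mixture {ι : Type*} [Fintype ι] [MeasurableSpace ι]
    [MeasurableSingletonClass ι] {c : ℝ≥0∞} {P : ι → Measure α} {f : ι → α → ℝ}
    (hm : ∀ i, Measurable (f i))
    (hf : ∀ i, Integrable (f i) (P i)) :
    ∫ x, f x.1 x.2 ∂mixture c P = c.toReal * ∑ i, ∫ x, f i x ∂P i := by
  have hm : Measurable fun x : ι × α => f x.1 x.2 := measurable_from_prod_countable_right hm
  rw [mixture, integral_smul_measure, integral_finsetSum_measure, smul_eq_mul]
  · congr 1
    refine Finset.sum_congr rfl fun i _ => ?_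
    rw [integral_map measurable_prodMk_left.aemeasurable hm.aestronglyMeasurable]
  · intro i _
    rw [integrable_map_measure hm.aestronglyMeasurable measurable_prodMk_left.aemeasurable]
    exact hf i

end LogDensity

/-! ### Le Cam's two point bound. -/

/-- Put `h = exp (ℓ/2)`. For fixed `u - v` the minimum of `u² + h² v²` is `(u - v)² h² / (1 + h²)`.
The square of `h - (1 + h²)/2` being nonnegative gives `h² / (1 + h²) ≥ h - (1 + h²)/4`, and `h ≥ 1
+ ℓ/2`. The resulting bound is affine in `ℓ` and `exp ℓ`, so it integrates under `P` to an
expression in the divergence alone, since `exp ℓ` has integral `1`. -/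
theorem sq_add_sq_mul_exp_ge (u v ℓ : ℝ) :
    (u - v) ^ 2 * (1 + ℓ / 2 - (1 + Real.exp ℓ) / 4) ≤ u ^ 2 + Real.exp ℓ * v ^ 2 := by
  set h := Real.exp (ℓ / 2) with hh
  have h1 : 1 + ℓ / 2 ≤ h := by linarith [Real.add_one_le_exp (ℓ / 2)]
  have h2 : Real.exp ℓ = h ^ 2 := by rw [hh, ← Real.exp_nat_mul]; congr 1; push_cast; ring
  rw [h2]
  have h3 : (u - v) ^ 2 * (1 + ℓ / 2 - (1 + h ^ 2) / 4) ≤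
      (u - v) ^ 2 * (h - (1 + h ^ 2) / 4) := by gcongr
  refine h3.trans ?_
  have h4 : (0 : ℝ) < 1 + h ^ 2 := by positivity
  refine le_of_mul_le_mul_left ?_ h4
  nlinarith [sq_nonneg (u + h ^ 2 * v), mul_nonneg (sq_nonneg (u - v))
    (sq_nonneg (h - (1 + h ^ 2) / 2))]

theorem ofReal_integral_le_lintegral_ofReal {α : Type*} [MeasurableSpace α] {P : Measure α}
    {f : α → ℝ} (hf : Integrable f P) :
    ENNReal.ofReal (∫ x, f x ∂P) ≤ ∫⁻ x, ENNReal.ofReal (f x) ∂P := by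
  have h : ∫ x, f x ∂P ≤ ∫ x, max (f x) 0 ∂P :=
    integral_mono hf hf.pos_part fun x => le_max_left _ _
  refine (ENNReal.ofReal_le_ofReal h).trans ?_
  rw [ofReal_integral_eq_lintegral_ofReal hf.pos_part (ae_of_all _ fun x => le_max_right _ _)]
  refine lintegral_mono fun x => ?_
  simp [ENNReal.ofReal_max]

/-- Le Cam's two point bound for the squared error, with the Kullback-Leibler divergence. -/
theorem two_point_bound {α : Type*} [MeasurableSpace α] {P Q : Measure α}
    [IsProbabilityMeasure P] [IsProbabilityMeasure Q] {ℓ : α → ℝ} (h : HasLogDensity P Q ℓ)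
    (hint : Integrable ℓ P) {κ : ℝ} (hκ : -κ ≤ ∫ x, ℓ x ∂P) {f : α → ℝ} (hf : Measurable f)
    (θ θ' : ℝ) :
    ENNReal.ofReal ((θ - θ') ^ 2 * ((1 - κ) / 2)) ≤
      ∫⁻ x, ENNReal.ofReal ((f x - θ) ^ 2) ∂P + ∫⁻ x, ENNReal.ofReal ((f x - θ') ^ 2) ∂Q := by
  have hexp : ∫⁻ x, ENNReal.ofReal (Real.exp (ℓ x)) ∂P = 1 := by
    have := measure_univ (μ := Q)
    rwa [h.2, withDensity_apply _ MeasurableSet.univ, Measure.restrict_univ] at this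
  have hexpi : Integrable (fun x => Real.exp (ℓ x)) P := by
    refine ⟨h.1.exp.aestronglyMeasurable, ?_⟩
    rw [hasFiniteIntegral_iff_ofReal (ae_of_all _ fun x => (Real.exp_pos _).le), hexp]
    exact ENNReal.one_lt_top
  have hexp1 : ∫ x, Real.exp (ℓ x) ∂P = 1 := by
    rw [integral_eq_lintegral_of_nonneg_ae (ae_of_all _ fun x => (Real.exp_pos _).le)
      h.1.exp.aestronglyMeasurable, hexp, ENNReal.toReal_one]
  have hi : Integrable (fun x => (θ - θ') ^ 2 * (1 + ℓ x / 2 - (1 + Real.exp (ℓ x)) / 4)) P :=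
    (((integrable_const _).add (hint.div_const _)).sub
      (((integrable_const _).add hexpi).div_const _)).const_mul _
  have hval : (θ - θ') ^ 2 * ((1 - κ) / 2) ≤
      ∫ x, (θ - θ') ^ 2 * (1 + ℓ x / 2 - (1 + Real.exp (ℓ x)) / 4) ∂P := by
    have h1 : Integrable (fun x => 1 + ℓ x / 2) P := (integrable_const _).add (hint.div_const _)
    have h2 : Integrable (fun x => 1 + Real.exp (ℓ x)) P := (integrable_const _).add hexpi
    rw [integral_const_mul, integral_sub h1 (h2.div_const _),
      integral_add (integrable_const _) (hint.div_const _), integral_div, integral_div,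
      integral_add (integrable_const _) hexpi, hexp1]
    simp only [integral_const, probReal_univ, smul_eq_mul, one_mul]
    refine mul_le_mul_of_nonneg_left ?_ (sq_nonneg _)
    linarith
  refine (ENNReal.ofReal_le_ofReal hval).trans
    ((ofReal_integral_le_lintegral_ofReal hi).trans ?_)
  rw [h.2, lintegral_withDensity_eq_lintegral_mul _ h.measurable_density
    ((hf.sub_const _).pow_const 2).ennreal_ofReal,
    ← lintegral_add_left ((hf.sub_const _).pow_const 2).ennreal_ofReal]
  refine lintegral_mono fun x => ?_
  simp only [Pi.mul_apply]
  rw [← ENNReal.ofReal_mul (Real.exp_pos _).le, ← ENNReal.ofReal_add (sq_nonneg _) (by positivity)]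
  refine ENNReal.ofReal_le_ofReal ?_
  have := sq_add_sq_mul_exp_ge (f x - θ) (f x - θ') (ℓ x)
  have e : (f x - θ - (f x - θ')) ^ 2 = (θ - θ') ^ 2 := by ring
  rwa [e] at this

/-! ### First and second moments of white Gaussian noise. -/

instance isProbabilityMeasure_iidGaussian (n : ℕ) (τ : ℝ) :
    IsProbabilityMeasure (iidGaussian n τ) := by
  unfold iidGaussian; infer_instance

section Moments

variable {n : ℕ} (τ : ℝ)

theorem memLp_apply_iidGaussian (i : Fin n) :
    MemLp (fun y : Fin n → ℝ => y i) 2 (iidGaussian n τ) :=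
  (memLp_id_gaussianReal (μ := 0) (v := (τ ^ 2).toNNReal) 2).comp_measurePreserving
    (measurePreserving_eval (fun _ : Fin n => gaussianReal 0 (τ ^ 2).toNNReal) i)

theorem integral_apply_iidGaussian (i : Fin n) : ∫ y, y i ∂iidGaussian n τ = 0 := by
  have h := (measurePreserving_eval (fun _ : Fin n => gaussianReal 0 (τ ^ 2).toNNReal) i).map_eq
  have h2 := integral_id_gaussianReal (μ := 0) (v := (τ ^ 2).toNNReal)
  rw [← h, integral_map (measurable_pi_apply i).aemeasurable
    (by fun_prop)] at h2
  exact h2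

theorem memLp_dotProduct_iidGaussian (w : Fin n → ℝ) :
    MemLp (fun y => w ⬝ᵥ y) 2 (iidGaussian n τ) :=
  memLp_finsetSum _ fun i _ => (memLp_apply_iidGaussian τ i).const_mul (w i)

theorem integral_dotProduct_iidGaussian (w : Fin n → ℝ) :
    ∫ y, w ⬝ᵥ y ∂iidGaussian n τ = 0 := by
  simp only [dotProduct]
  rw [integral_finsetSum _ fun i _ =>
    ((memLp_apply_iidGaussian τ i).integrable one_le_two).const_mul (w i)]
  simp [integral_const_mul, integral_apply_iidGaussian]

theorem integral_sq_dotProduct_iidGaussian (w : Fin n → ℝ) :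
    ∫ y, (w ⬝ᵥ y) ^ 2 ∂iidGaussian n τ = τ ^ 2 * (w ⬝ᵥ w) := by
  have hvar := variance_sum_pi (ι := Fin n) (μ := fun _ => gaussianReal 0 (τ ^ 2).toNNReal)
    (X := fun i x => w i * x)
    (fun i => (memLp_id_gaussianReal (μ := 0) (v := (τ ^ 2).toNNReal) 2).const_mul (w i))
  have h0 := variance_of_integral_eq_zero
    (memLp_dotProduct_iidGaussian τ w).aestronglyMeasurable.aemeasurable
    (integral_dotProduct_iidGaussian τ w)
  rw [← h0]
  have e : (fun y : Fin n → ℝ => w ⬝ᵥ y) = ∑ i, fun x : Fin n → ℝ => w i * x i := by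
    ext y; simp [dotProduct]
  rw [e]
  refine hvar.trans ?_
  rw [dotProduct, Finset.mul_sum]
  refine Finset.sum_congr rfl fun i _ => ?_
  rw [variance_const_mul (w i) (fun x => x), variance_fun_id_gaussianReal, Real.coe_toNNReal _ (sq_nonneg _)]
  ring

theorem integral_sq_apply_iidGaussian (i : Fin n) :
    ∫ y, y i ^ 2 ∂iidGaussian n τ = τ ^ 2 := by
  have := integral_sq_dotProduct_iidGaussian τ (Pi.single i 1 : Fin n → ℝ)
  simpa using this

end Moments

/-! ### Gaussian noise with a random spike in one direction. -/

theorem hasLogDensity_gaussianReal {v : NNReal} (hv : v ≠ 0) (c : ℝ) :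
    HasLogDensity (gaussianReal 0 v) (gaussianReal c v)
      (fun x => c * x / v - c ^ 2 / (2 * v)) := by
  refine ⟨by fun_prop, ?_⟩
  rw [gaussianReal_of_var_ne_zero _ hv, gaussianReal_of_var_ne_zero _ hv,
    ← withDensity_mul _ (measurable_gaussianPDF _ _) (by fun_prop)]
  congr 1
  ext x
  have hv' : (v : ℝ) ≠ 0 := by exact_mod_cast hv
  simp only [Pi.mul_apply, gaussianPDF]
  rw [← ENNReal.ofReal_mul (gaussianPDFReal_nonneg _ _ _)]
  congr 1
  simp only [gaussianPDFReal]
  rw [mul_assoc (√_)⁻¹, ← Real.exp_add]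
  congr 2
  field_simp
  ring

theorem hasLogDensity_iidGaussian_map_add {n : ℕ} {σ : ℝ} (hσ : 0 < σ) (c : Fin n → ℝ) :
    HasLogDensity (iidGaussian n σ) ((iidGaussian n σ).map fun y => c + y)
      (fun y => c ⬝ᵥ y / σ ^ 2 - c ⬝ᵥ c / (2 * σ ^ 2)) := by
  have hv : (σ ^ 2).toNNReal ≠ 0 := by simpa using hσ.ne'
  have hc : ((σ ^ 2).toNNReal : ℝ) = σ ^ 2 := Real.coe_toNNReal _ (sq_nonneg _)
  have h := HasLogDensity.pi fun i : Fin n => hasLogDensity_gaussianReal hv (c i)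
  have hmap : (iidGaussian n σ).map (fun y => c + y) =
      Measure.pi fun i => gaussianReal (c i) (σ ^ 2).toNNReal := by
    have := Measure.pi_map_pi (μ := fun _ : Fin n => gaussianReal 0 (σ ^ 2).toNNReal)
      (f := fun i x => c i + x) (fun i => by fun_prop)
    simp only [gaussianReal_map_const_add, zero_add] at this
    exact this
  rw [hmap]
  have e : (fun y : Fin n → ℝ => c ⬝ᵥ y / σ ^ 2 - c ⬝ᵥ c / (2 * σ ^ 2)) =
      fun y => ∑ i, (c i * y i / ((σ ^ 2).toNNReal : ℝ) -
        c i ^ 2 / (2 * ((σ ^ 2).toNNReal : ℝ))) := by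
    ext y
    simp only [hc, dotProduct, Finset.sum_sub_distrib, Finset.sum_div, pow_two (c _)]
  rw [e]
  exact h

/-- Law of `ζ d + n` with independent `ζ ~ N(0, σₐ²)` and `n ~ N(0, σ² I)`. -/
noncomputable def spikeLaw {n : ℕ} (σa σ : ℝ) (d : Fin n → ℝ) : Measure (Fin n → ℝ) :=
  ((gaussianReal 0 (σa ^ 2).toNNReal).prod (iidGaussian n σ)).map fun q => q.1 • d + q.2

theorem measurable_spike {n : ℕ} (d : Fin n → ℝ) :
    Measurable fun q : ℝ × (Fin n → ℝ) => q.1 • d + q.2 := by fun_prop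

instance isProbabilityMeasure_spikeLaw {n : ℕ} (σa σ : ℝ) (d : Fin n → ℝ) :
    IsProbabilityMeasure (spikeLaw σa σ d) :=
  Measure.isProbabilityMeasure_map (measurable_spike d).aemeasurable

/-- Complete the square in `ζ`: the integrand times the prior density is a constant times the
posterior density of `ζ`, Gaussian with mean `σₐ² t / (σₐ² + σ²)` and variance `v'`. The constant is
written as an exponential to serve as a log-density. -/
theorem lintegral_exp_quadratic_gaussianReal {σa σ : ℝ} (hσa : 0 < σa) (hσ : 0 < σ) (t : ℝ) :
    ∫⁻ ζ, ENNReal.ofReal (Real.exp (ζ * t / σ ^ 2 - ζ ^ 2 / (2 * σ ^ 2)))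
        ∂gaussianReal 0 (σa ^ 2).toNNReal =
      ENNReal.ofReal (Real.exp (σa ^ 2 / (2 * σ ^ 2 * (σa ^ 2 + σ ^ 2)) * t ^ 2 +
        Real.log (√(σ ^ 2 / (σa ^ 2 + σ ^ 2))))) := by
  have hv : (σa ^ 2).toNNReal ≠ 0 := by simpa using hσa.ne'
  have hc : ((σa ^ 2).toNNReal : ℝ) = σa ^ 2 := Real.coe_toNNReal _ (sq_nonneg _)
  set v' : NNReal := (σa ^ 2 * σ ^ 2 / (σa ^ 2 + σ ^ 2)).toNNReal with hv'
  have hv'0 : 0 < σa ^ 2 * σ ^ 2 / (σa ^ 2 + σ ^ 2) := by positivity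
  have hv'1 : v' ≠ 0 := by simpa [hv'] using hv'0
  have hv'c : (v' : ℝ) = σa ^ 2 * σ ^ 2 / (σa ^ 2 + σ ^ 2) := Real.coe_toNNReal _ hv'0.le
  have hsq : 0 < √(σ ^ 2 / (σa ^ 2 + σ ^ 2)) := by positivity
  rw [gaussianReal_of_var_ne_zero _ hv, lintegral_withDensity_eq_lintegral_mul _
    (measurable_gaussianPDF _ _) (by fun_prop)]
  set K := Real.exp (σa ^ 2 / (2 * σ ^ 2 * (σa ^ 2 + σ ^ 2)) * t ^ 2 +
        Real.log (√(σ ^ 2 / (σa ^ 2 + σ ^ 2)))) with hK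
  have key : ∀ ζ : ℝ, (gaussianPDF 0 (σa ^ 2).toNNReal * fun ζ : ℝ =>
      ENNReal.ofReal (Real.exp (ζ * t / σ ^ 2 - ζ ^ 2 / (2 * σ ^ 2)))) ζ =
      ENNReal.ofReal K * gaussianPDF (σa ^ 2 * t / (σa ^ 2 + σ ^ 2)) v' ζ := by
    intro ζ
    simp only [Pi.mul_apply, gaussianPDF]
    rw [← ENNReal.ofReal_mul (gaussianPDFReal_nonneg _ _ _), ← ENNReal.ofReal_mul (by positivity)]
    congr 1
    simp only [gaussianPDFReal, hc, hv'c]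
    rw [hK, Real.exp_add, Real.exp_log hsq]
    have e1 : (√(2 * Real.pi * σa ^ 2))⁻¹ = √(σ ^ 2 / (σa ^ 2 + σ ^ 2)) *
        (√(2 * Real.pi * (σa ^ 2 * σ ^ 2 / (σa ^ 2 + σ ^ 2))))⁻¹ := by
      rw [← Real.sqrt_inv, ← Real.sqrt_inv, ← Real.sqrt_mul (by positivity)]
      congr 1
      field_simp
    rw [e1]
    have e2 : Real.exp (-(ζ - 0) ^ 2 / (2 * σa ^ 2)) *
        Real.exp (ζ * t / σ ^ 2 - ζ ^ 2 / (2 * σ ^ 2)) =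
        Real.exp (σa ^ 2 / (2 * σ ^ 2 * (σa ^ 2 + σ ^ 2)) * t ^ 2) *
        Real.exp (-(ζ - σa ^ 2 * t / (σa ^ 2 + σ ^ 2)) ^ 2 /
          (2 * (σa ^ 2 * σ ^ 2 / (σa ^ 2 + σ ^ 2)))) := by
      rw [← Real.exp_add, ← Real.exp_add]
      congr 1
      field_simp
      ring
    linear_combination √(σ ^ 2 / (σa ^ 2 + σ ^ 2)) *
        (√(2 * Real.pi * (σa ^ 2 * σ ^ 2 / (σa ^ 2 + σ ^ 2))))⁻¹ * e2
  simp_rw [key]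
  rw [lintegral_const_mul _ (measurable_gaussianPDF _ _), lintegral_gaussianPDF_eq_one _ hv'1,
    mul_one]

/-- Given `ζ` the law is a translate of the noise, whose log-density depends on `y` only through `d
⬝ᵥ y`; then `ζ` is integrated out by Tonelli. The additive constant is the same for all unit `d`, so
it cancels when two spikes are compared. -/
theorem hasLogDensity_spikeLaw {n : ℕ} {σa σ : ℝ} (hσa : 0 < σa) (hσ : 0 < σ) {d : Fin n → ℝ}
    (hd : d ⬝ᵥ d = 1) :
    HasLogDensity (iidGaussian n σ) (spikeLaw σa σ d) (fun y =>
      σa ^ 2 / (2 * σ ^ 2 * (σa ^ 2 + σ ^ 2)) * (d ⬝ᵥ y) ^ 2 +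
        Real.log (√(σ ^ 2 / (σa ^ 2 + σ ^ 2)))) := by
  have hdm : Measurable fun y : Fin n → ℝ => d ⬝ᵥ y := by unfold dotProduct; fun_prop
  have hm : Measurable (fun y : Fin n → ℝ =>
      σa ^ 2 / (2 * σ ^ 2 * (σa ^ 2 + σ ^ 2)) * (d ⬝ᵥ y) ^ 2 +
        Real.log (√(σ ^ 2 / (σa ^ 2 + σ ^ 2)))) := by fun_prop
  refine ⟨hm, Measure.ext_of_lintegral _ fun f hf => ?_⟩
  rw [lintegral_withDensity_eq_lintegral_mul _ hm.exp.ennreal_ofReal hf, spikeLaw,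
    lintegral_map hf (measurable_spike d),
    lintegral_prod (fun q : ℝ × (Fin n → ℝ) => f (q.1 • d + q.2)) (hf.comp (measurable_spike d)).aemeasurable]
  have h1 : ∀ ζ : ℝ, ∫⁻ y, f (ζ • d + y) ∂iidGaussian n σ =
      ∫⁻ y, ENNReal.ofReal (Real.exp (ζ * (d ⬝ᵥ y) / σ ^ 2 - ζ ^ 2 / (2 * σ ^ 2))) * f y
        ∂iidGaussian n σ := by
    intro ζ
    have h := hasLogDensity_iidGaussian_map_add hσ (ζ • d)
    rw [← lintegral_map (f := f) (g := fun y => ζ • d + y) hf (by fun_prop), h.2,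
      lintegral_withDensity_eq_lintegral_mul _ h.measurable_density hf]
    refine lintegral_congr fun y => ?_
    simp [hd, pow_two]
  simp_rw [h1]
  rw [lintegral_lintegral_swap]
  · refine lintegral_congr fun y => ?_
    rw [lintegral_mul_const _ (by fun_prop), lintegral_exp_quadratic_gaussianReal hσa hσ]
    rfl
  · refine Measurable.aemeasurable ?_
    refine Measurable.mul ?_ (hf.comp measurable_snd)
    have : Measurable fun q : ℝ × (Fin n → ℝ) => d ⬝ᵥ q.2 := hdm.comp measurable_snd
    fun_prop

theorem integrable_sq_dotProduct_spikeLaw {n : ℕ} (σa σ : ℝ) (d w : Fin n → ℝ) :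
    Integrable (fun y => (w ⬝ᵥ y) ^ 2) (spikeLaw σa σ d) ∧
      ∫ y, (w ⬝ᵥ y) ^ 2 ∂spikeLaw σa σ d = σa ^ 2 * (w ⬝ᵥ d) ^ 2 + σ ^ 2 * (w ⬝ᵥ w) := by
  have hdm : Measurable fun y : Fin n → ℝ => (w ⬝ᵥ y) ^ 2 := by unfold dotProduct; fun_prop
  set γ := gaussianReal 0 (σa ^ 2).toNNReal
  have hz : MemLp (fun z : ℝ => z) 2 γ := memLp_id_gaussianReal 2
  have hz0 : ∫ z, z ∂γ = 0 := integral_id_gaussianReal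
  have hz2 : ∫ z, z ^ 2 ∂γ = σa ^ 2 := by
    rw [← variance_of_integral_eq_zero (X := fun z : ℝ => z) (by fun_prop) hz0,
      variance_fun_id_gaussianReal, Real.coe_toNNReal _ (sq_nonneg _)]
  have hw := memLp_dotProduct_iidGaussian σ w
  have i1 : Integrable (fun q : ℝ × (Fin n → ℝ) => (w ⬝ᵥ d) ^ 2 * q.1 ^ 2)
      (γ.prod (iidGaussian n σ)) := (hz.integrable_sq.comp_fst _).const_mul _
  have i2 : Integrable (fun q : ℝ × (Fin n → ℝ) => 2 * (w ⬝ᵥ d) * (q.1 * (w ⬝ᵥ q.2)))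
      (γ.prod (iidGaussian n σ)) :=
    ((hz.integrable one_le_two).mul_prod (hw.integrable one_le_two)).const_mul _
  have i3 : Integrable (fun q : ℝ × (Fin n → ℝ) => (w ⬝ᵥ q.2) ^ 2)
      (γ.prod (iidGaussian n σ)) := hw.integrable_sq.comp_snd _
  have e : ∀ q : ℝ × (Fin n → ℝ), (w ⬝ᵥ (q.1 • d + q.2)) ^ 2 =
      (w ⬝ᵥ d) ^ 2 * q.1 ^ 2 + 2 * (w ⬝ᵥ d) * (q.1 * (w ⬝ᵥ q.2)) + (w ⬝ᵥ q.2) ^ 2 := by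
    intro q
    rw [dotProduct_add, dotProduct_smul, smul_eq_mul]
    ring
  constructor
  · rw [spikeLaw, integrable_map_measure hdm.aestronglyMeasurable (measurable_spike d).aemeasurable]
    simp only [Function.comp_def, e]
    exact (i1.add i2).add i3
  · rw [spikeLaw, integral_map (measurable_spike d).aemeasurable hdm.aestronglyMeasurable]
    simp only [e]
    have i12 : Integrable (fun q : ℝ × (Fin n → ℝ) =>
        (w ⬝ᵥ d) ^ 2 * q.1 ^ 2 + 2 * (w ⬝ᵥ d) * (q.1 * (w ⬝ᵥ q.2)))
        (γ.prod (iidGaussian n σ)) := i1.add i2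
    rw [integral_add i12 i3, integral_add i1 i2, integral_const_mul, integral_const_mul,
      integral_prod_mul (fun z : ℝ => z) (fun y : Fin n → ℝ => w ⬝ᵥ y),
      integral_fun_fst (fun z : ℝ => z ^ 2), integral_fun_snd (fun y : Fin n → ℝ => (w ⬝ᵥ y) ^ 2),
      hz0, hz2, integral_sq_dotProduct_iidGaussian]
    simp only [probReal_univ, one_smul]
    ring

/-- The log-likelihood ratio of `spikeLaw d'` with respect to `spikeLaw d`. -/
noncomputable def spikeLLR {n : ℕ} (σa σ : ℝ) (d d' : Fin n → ℝ) (y : Fin n → ℝ) : ℝ :=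
  σa ^ 2 / (2 * σ ^ 2 * (σa ^ 2 + σ ^ 2)) * ((d' ⬝ᵥ y) ^ 2 - (d ⬝ᵥ y) ^ 2)

theorem hasLogDensity_spikeLaw_spikeLaw {n : ℕ} {σa σ : ℝ} (hσa : 0 < σa) (hσ : 0 < σ)
    {d d' : Fin n → ℝ} (hd : d ⬝ᵥ d = 1) (hd' : d' ⬝ᵥ d' = 1) :
    HasLogDensity (spikeLaw σa σ d) (spikeLaw σa σ d') (spikeLLR σa σ d d') := by
  convert (hasLogDensity_spikeLaw hσa hσ hd).of_common (hasLogDensity_spikeLaw hσa hσ hd')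
    using 2 with y
  simp only [spikeLLR]
  ring

theorem integrable_spikeLLR {n : ℕ} (σa σ : ℝ) (d d' : Fin n → ℝ) :
    Integrable (spikeLLR σa σ d d') (spikeLaw σa σ d) :=
  ((integrable_sq_dotProduct_spikeLaw σa σ d d').1.sub
    (integrable_sq_dotProduct_spikeLaw σa σ d d).1).const_mul _

/-- With `c = d' ⬝ᵥ d`, the divergence is exactly `σₐ⁴ (1 - c²) / (2σ² (σₐ² + σ²))`. Drop `σₐ²` from
the denominator and use `1 - c² ≤ 2 (1 - c) = ‖d - d'‖²`. -/
theorem integral_spikeLLR_ge {n : ℕ} {σa σ : ℝ} (hσa : 0 < σa) (hσ : 0 < σ)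
    {d d' : Fin n → ℝ} (hd : d ⬝ᵥ d = 1) (hd' : d' ⬝ᵥ d' = 1) :
    -((σa ^ 2 / σ ^ 2) ^ 2 / 2 * ((d - d') ⬝ᵥ (d - d'))) ≤
      ∫ y, spikeLLR σa σ d d' y ∂spikeLaw σa σ d := by
  have h := integrable_sq_dotProduct_spikeLaw σa σ d
  simp only [spikeLLR]
  rw [integral_const_mul, integral_sub (h d').1 (h d).1, (h d').2, (h d).2, hd, hd']
  set c := d' ⬝ᵥ d
  have hc : d ⬝ᵥ d' = c := dotProduct_comm _ _
  have hdd : (d - d') ⬝ᵥ (d - d') = 2 * (1 - c) := by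
    rw [sub_dotProduct, dotProduct_sub, dotProduct_sub, hd, hd', hc]
    ring
  rw [hdd]
  have hc2 : 0 ≤ 2 * (1 - c) := by
    rw [← hdd]; exact Finset.sum_nonneg fun i _ => mul_self_nonneg _
  have hb : σa ^ 2 / (2 * σ ^ 2 * (σa ^ 2 + σ ^ 2)) * σa ^ 2 ≤ (σa ^ 2 / σ ^ 2) ^ 2 / 2 := by
    rw [div_pow, div_div, div_mul_eq_mul_div, div_le_div_iff₀ (by positivity) (by positivity)]
    have : 0 ≤ σa ^ 2 * σa ^ 2 * (2 * σ ^ 2 * σa ^ 2) := by positivity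
    nlinarith
  have h1 : 1 - c ^ 2 ≤ 2 * (1 - c) := by nlinarith [sq_nonneg (1 - c)]
  have hbp : 0 ≤ σa ^ 2 / (2 * σ ^ 2 * (σa ^ 2 + σ ^ 2)) * σa ^ 2 := by positivity
  have h2 := mul_le_mul_of_nonneg_left h1 hbp
  have h3 := mul_le_mul_of_nonneg_right hb hc2
  nlinarith

/-! ### Separating one column from the rest of the observation. -/

/-- Resampling one coordinate from its own marginal preserves a product law. This lets an
independent spike amplitude take the place of the coefficient of column `k`. -/
theorem pi_map_update {ι : Type*} [Fintype ι] [DecidableEq ι] {E : ι → Type*}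
    [∀ i, MeasurableSpace (E i)] (μ : ∀ i, Measure (E i)) [∀ i, IsProbabilityMeasure (μ i)]
    (j : ι) :
    ((Measure.pi μ).prod (μ j)).map (fun q => Function.update q.1 j q.2) = Measure.pi μ := by
  have hm : Measurable fun q : (∀ i, E i) × E j => Function.update q.1 j q.2 :=
    measurable_update'
  refine (Measure.pi_eq fun s hs => ?_).symm
  rw [Measure.map_apply hm (MeasurableSet.univ_pi hs)]
  have : (fun q : (∀ i, E i) × E j => Function.update q.1 j q.2) ⁻¹' Set.univ.pi s =
      (Set.univ.pi (Function.update s j Set.univ)) ×ˢ s j := by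
    ext q
    simp only [Set.mem_preimage, Set.mem_univ_pi, Set.mem_prod]
    constructor
    · intro h
      refine ⟨fun i => ?_, by simpa using h j⟩
      by_cases hi : i = j
      · subst hi; simp
      · simpa [hi] using h i
    · rintro ⟨h, hj⟩ i
      by_cases hi : i = j
      · subst hi; simpa using hj
      · simpa [hi] using h i
  rw [this, Measure.prod_prod, Measure.pi_pi, ← Finset.prod_erase_mul _ _ (Finset.mem_univ j),
    ← Finset.prod_erase_mul _ (fun i => μ i (s i)) (Finset.mem_univ j)]
  simp only [Function.update_self, measure_univ, mul_one]
  congr 1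
  refine Finset.prod_congr rfl fun i hi => ?_
  rw [Function.update_of_ne (Finset.ne_of_mem_erase hi)]

instance measurableSpacePerm (p : ℕ) : MeasurableSpace (Equiv.Perm (Fin p)) := ⊤

instance discreteMeasurableSpacePerm (p : ℕ) : DiscreteMeasurableSpace (Equiv.Perm (Fin p)) :=
  ⟨fun _ => trivial⟩

variable {m p s : ℕ}

/-- The coefficient vector `P (zᵀ, 0)ᵀ` for a fixed permutation. -/
noncomputable def coeff (π : Equiv.Perm (Fin p)) (z : Fin s → ℝ) : Fin p → ℝ :=
  fun i => zeroPad p z (π i)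

theorem permMatrix_mulVec_zeroPad (π : Equiv.Perm (Fin p)) (z : Fin s → ℝ) :
    π.permMatrix ℝ *ᵥ zeroPad p z = coeff π z := by
  rw [Matrix.permMatrix_mulVec]; rfl

theorem measurable_coeff (π : Equiv.Perm (Fin p)) :
    Measurable (coeff π : (Fin s → ℝ) → Fin p → ℝ) := by
  refine measurable_pi_lambda _ fun i => ?_
  unfold coeff zeroPad
  split_ifs
  · exact measurable_pi_apply _
  · exact measurable_const

theorem measurable_mulVec (D : Matrix (Fin m) (Fin p) ℝ) : Measurable fun x => D *ᵥ x := by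
  refine measurable_pi_lambda _ fun i => ?_
  simp only [Matrix.mulVec, dotProduct]
  fun_prop

/-- The law of the coefficients `z` and of the part of the observation due to column `k` and the
noise, given the permutation `π`. -/
noncomputable def splitLaw (s : ℕ) (σa σ : ℝ) (d : Fin m → ℝ) (k : Fin p)
    (π : Equiv.Perm (Fin p)) : Measure ((Fin s → ℝ) × (Fin m → ℝ)) :=
  (iidGaussian s σa).prod (if (π k : ℕ) < s then spikeLaw σa σ d else iidGaussian m σ)

instance isProbabilityMeasure_splitLaw (s : ℕ) (σa σ : ℝ) (d : Fin m → ℝ) (k : Fin p)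
    (π : Equiv.Perm (Fin p)) : IsProbabilityMeasure (splitLaw s σa σ d k π) := by
  unfold splitLaw; split_ifs <;> infer_instance

/-- The observation as a function of the data of `splitLaw`; it does not involve column `k`
of `D`. -/
noncomputable def recombine (D : Matrix (Fin m) (Fin p) ℝ) (k : Fin p) (π : Equiv.Perm (Fin p))
    (q : (Fin s → ℝ) × (Fin m → ℝ)) : Fin m → ℝ :=
  D *ᵥ Function.update (coeff π q.1) k 0 + q.2

theorem measurable_recombine (D : Matrix (Fin m) (Fin p) ℝ) (k : Fin p)
    (π : Equiv.Perm (Fin p)) :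
    Measurable (recombine D k π : (Fin s → ℝ) × (Fin m → ℝ) → Fin m → ℝ) := by
  have h : Measurable fun z : Fin s → ℝ => Function.update (coeff π z) k 0 :=
    measurable_update_left.comp (measurable_coeff π)
  exact ((measurable_mulVec D).comp (h.comp measurable_fst)).add measurable_snd

theorem measurable_mulVec_coeff_add (D : Matrix (Fin m) (Fin p) ℝ) (π : Equiv.Perm (Fin p)) :
    Measurable fun q : (Fin s → ℝ) × (Fin m → ℝ) => D *ᵥ coeff π q.1 + q.2 :=
  ((measurable_mulVec D).comp ((measurable_coeff π).comp measurable_fst)).add measurable_snd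

theorem coeff_update (π : Equiv.Perm (Fin p)) (k : Fin p) (hk : (π k : ℕ) < s)
    (z : Fin s → ℝ) (ζ : ℝ) :
    coeff π (Function.update z ⟨π k, hk⟩ ζ) = Function.update (coeff π z) k ζ := by
  ext i
  by_cases hi : i = k
  · subst hi
    simp [coeff, zeroPad, hk]
  · rw [Function.update_of_ne hi]
    simp only [coeff, zeroPad]
    split_ifs with h
    · rw [Function.update_of_ne]
      intro h'
      simp only [Fin.mk.injEq] at h'
      exact hi (π.injective (Fin.ext h'))
    · rfl

theorem mulVec_update (D : Matrix (Fin m) (Fin p) ℝ) (x : Fin p → ℝ) (k : Fin p) (ζ : ℝ) :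
    D *ᵥ Function.update x k ζ = D *ᵥ Function.update x k 0 + ζ • Dᵀ k := by
  have : Function.update x k ζ = Function.update x k 0 + Pi.single k ζ := by
    ext i
    by_cases hi : i = k
    · subst hi; simp
    · simp [hi]
  rw [this, Matrix.mulVec_add, Matrix.mulVec_single]
  congr 1
  ext i
  simp [mul_comm]

/-- If column `k` is active, `recombine` discards its coefficient in `z` and the spike supplies a
fresh one, which is a resampling. If it is inactive, the coefficient is already zero and only noise
is added. -/
theorem map_splitLaw (D : Matrix (Fin m) (Fin p) ℝ) (σa σ : ℝ) (k : Fin p)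
    (π : Equiv.Perm (Fin p)) :
    (splitLaw s σa σ (Dᵀ k) k π).map (recombine D k π) =
      ((iidGaussian s σa).prod (iidGaussian m σ)).map
        fun q => D *ᵥ coeff π q.1 + q.2 := by
  by_cases hk : (π k : ℕ) < s
  · refine Measure.ext_of_lintegral _ fun f hf => ?_
    have hr := measurable_recombine (s := s) D k π
    have hc := measurable_mulVec_coeff_add (s := s) D π
    have hs := measurable_spike (Dᵀ k)
    rw [lintegral_map hf hr, lintegral_map hf hc, splitLaw, if_pos hk,
      lintegral_prod (fun q => f (recombine D k π q)) (hf.comp hr).aemeasurable,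
      lintegral_prod (fun q : (Fin s → ℝ) × (Fin m → ℝ) => f (D *ᵥ coeff π q.1 + q.2))
        (hf.comp hc).aemeasurable]
    set G : (Fin s → ℝ) → ℝ≥0∞ := fun z =>
      ∫⁻ y, f (D *ᵥ coeff π z + y) ∂iidGaussian m σ with hG
    have hGm : Measurable G := (hf.comp hc).lintegral_prod_right'
    have hu : Measurable fun q : (Fin s → ℝ) × ℝ => Function.update q.1 ⟨π k, hk⟩ q.2 :=
      measurable_update'
    have h1 : ∀ z : Fin s → ℝ, ∫⁻ y, f (recombine D k π (z, y)) ∂spikeLaw σa σ (Dᵀ k) =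
        ∫⁻ ζ, G (Function.update z ⟨π k, hk⟩ ζ) ∂gaussianReal 0 (σa ^ 2).toNNReal := by
      intro z
      have hz : Measurable fun y => f (recombine D k π (z, y)) :=
        hf.comp (hr.comp measurable_prodMk_left)
      rw [spikeLaw, lintegral_map hz hs,
        lintegral_prod (fun q : ℝ × (Fin m → ℝ) => f (recombine D k π (z, q.1 • Dᵀ k + q.2)))
          (hz.comp hs).aemeasurable]
      refine lintegral_congr fun ζ => lintegral_congr fun y => ?_
      simp only [recombine]
      rw [coeff_update, mulVec_update _ _ _ ζ, add_assoc]
    simp_rw [h1]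
    rw [← lintegral_prod (fun q : (Fin s → ℝ) × ℝ => G (Function.update q.1 ⟨π k, hk⟩ q.2))
      (hGm.comp hu).aemeasurable, ← lintegral_map (f := G) hGm hu]
    have := pi_map_update (fun _ : Fin s => gaussianReal 0 (σa ^ 2).toNNReal) ⟨π k, hk⟩
    rw [iidGaussian, this]
  · have h0 : ∀ z : Fin s → ℝ, Function.update (coeff π z) k 0 = coeff π z := by
      intro z
      rw [Function.update_eq_self_iff]
      simp [coeff, zeroPad, hk]
    rw [splitLaw, if_neg hk]
    congr 1
    ext q
    simp only [recombine, h0]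

theorem obsLaw_eq_sum (s : ℕ) (σa σ : ℝ) (D : Matrix (Fin m) (Fin p) ℝ) :
    obsLaw s σa σ D = (p ! : ℝ≥0∞)⁻¹ • ∑ π : Equiv.Perm (Fin p),
      ((iidGaussian s σa).prod (iidGaussian m σ)).map fun q => D *ᵥ coeff π q.1 + q.2 := by
  have hm : Measurable fun xn : (Fin p → ℝ) × (Fin m → ℝ) => D *ᵥ xn.1 + xn.2 :=
    ((measurable_mulVec D).comp measurable_fst).add measurable_snd
  refine Measure.ext_of_lintegral _ fun f hf => ?_
  have hfm := hf.comp hm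
  rw [obsLaw, lintegral_map hf hm,
    lintegral_prod (fun xn : (Fin p → ℝ) × (Fin m → ℝ) => f (D *ᵥ xn.1 + xn.2)) hfm.aemeasurable,
    coeffLaw]
  simp only [permMatrix_mulVec_zeroPad, lintegral_smul_measure, lintegral_finsetSum_measure]
  congr 1
  refine Finset.sum_congr rfl fun π _ => ?_
  have hG : Measurable fun x => ∫⁻ y, f (D *ᵥ x + y) ∂iidGaussian m σ :=
    hfm.lintegral_prod_right'
  rw [lintegral_map hG (measurable_coeff π),
    lintegral_map hf (measurable_mulVec_coeff_add D π),
    lintegral_prod (fun q : (Fin s → ℝ) × (Fin m → ℝ) => f (D *ᵥ coeff π q.1 + q.2))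
      (hf.comp (measurable_mulVec_coeff_add D π)).aemeasurable]

theorem isProbabilityMeasure_mixture {α : Type*} [MeasurableSpace α]
    (P : Equiv.Perm (Fin p) → Measure α) [∀ π, IsProbabilityMeasure (P π)] :
    IsProbabilityMeasure (mixture (p ! : ℝ≥0∞)⁻¹ P) := by
  constructor
  simp only [mixture, Measure.smul_apply, Measure.finsetSum_apply, smul_eq_mul,
    Measure.map_apply measurable_prodMk_left MeasurableSet.univ, Set.preimage_univ, measure_univ,
    Finset.sum_const, Finset.card_univ, Fintype.card_perm, Fintype.card_fin, nsmul_eq_mul, mul_one]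
  exact ENNReal.inv_mul_cancel (by exact_mod_cast p.factorial_ne_zero) (ENNReal.natCast_ne_top _)

theorem measurable_recombine_mixture (D : Matrix (Fin m) (Fin p) ℝ) (k : Fin p) :
    Measurable fun x : Equiv.Perm (Fin p) × ((Fin s → ℝ) × (Fin m → ℝ)) =>
      recombine D k x.1 x.2 :=
  measurable_from_prod_countable_right fun π => measurable_recombine D k π

theorem obsLaw_eq_map_mixture (s : ℕ) (σa σ : ℝ) (D : Matrix (Fin m) (Fin p) ℝ) (k : Fin p) :
    obsLaw s σa σ D = (mixture (p ! : ℝ≥0∞)⁻¹ (splitLaw s σa σ (Dᵀ k) k)).map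
      fun x => recombine D k x.1 x.2 := by
  have hm := measurable_recombine_mixture (s := s) D k
  refine Measure.ext_of_lintegral _ fun f hf => ?_
  rw [obsLaw_eq_sum, lintegral_map hf hm]
  simp only [mixture, lintegral_smul_measure, lintegral_finsetSum_measure]
  congr 1
  refine Finset.sum_congr rfl fun π _ => ?_
  have hfm : Measurable fun x : Equiv.Perm (Fin p) × ((Fin s → ℝ) × (Fin m → ℝ)) =>
    f (recombine D k x.1 x.2) := hf.comp hm
  rw [lintegral_map hfm measurable_prodMk_left, ← map_splitLaw D σa σ k π,
    lintegral_map hf (measurable_recombine D k π)]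

/-! ### Divergence of the full model, averaged over supports. -/

/-- This is the uniformity of `π k`: right multiplication by a transposition shows that the sum does
not depend on `k`, so one may average over `k`. -/
theorem sum_perm_apply (f : Fin p → ℝ) (k : Fin p) :
    (p : ℝ) * ∑ π : Equiv.Perm (Fin p), f (π k) = (p ! : ℝ) * ∑ i, f i := by
  have h : ∀ l : Fin p, ∑ π : Equiv.Perm (Fin p), f (π l) =
      ∑ π : Equiv.Perm (Fin p), f (π k) := by
    intro l
    refine Fintype.sum_equiv (Equiv.mulRight (Equiv.swap k l)) _ _ fun π => ?_
    simp
  have h1 : ∑ l : Fin p, ∑ π : Equiv.Perm (Fin p), f (π l) =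
      (p : ℝ) * ∑ π : Equiv.Perm (Fin p), f (π k) := by simp [h]
  rw [← h1, Finset.sum_comm]
  simp [Equiv.sum_comp, Fintype.card_perm]

theorem sum_ite_val_lt (hsp : s ≤ p) (c : ℝ) :
    ∑ i : Fin p, (if (i : ℕ) < s then c else 0) = s * c := by
  rw [Fin.sum_univ_eq_sum_range (fun i => if i < s then c else 0) p, ← Finset.sum_filter]
  have : (Finset.range p).filter (fun i => i < s) = Finset.range s := by
    ext i; simp; omega
  simp [this]

/-- The log-likelihood ratio of `splitLaw d'` with respect to `splitLaw d`. -/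
noncomputable def splitLLR (s : ℕ) (σa σ : ℝ) (d d' : Fin m → ℝ) (k : Fin p)
    (π : Equiv.Perm (Fin p)) (q : (Fin s → ℝ) × (Fin m → ℝ)) : ℝ :=
  if (π k : ℕ) < s then spikeLLR σa σ d d' q.2 else 0

theorem hasLogDensity_splitLaw (s : ℕ) {σa σ : ℝ} (hσa : 0 < σa) (hσ : 0 < σ)
    {d d' : Fin m → ℝ} (hd : d ⬝ᵥ d = 1) (hd' : d' ⬝ᵥ d' = 1) (k : Fin p)
    (π : Equiv.Perm (Fin p)) :
    HasLogDensity (splitLaw s σa σ d k π) (splitLaw s σa σ d' k π)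
      (splitLLR s σa σ d d' k π) := by
  unfold splitLaw splitLLR
  split_ifs
  · exact (hasLogDensity_spikeLaw_spikeLaw hσa hσ hd hd').prod_left _
  · exact HasLogDensity.refl _

theorem integrable_splitLLR (s : ℕ) (σa σ : ℝ) (d d' : Fin m → ℝ) (k : Fin p)
    (π : Equiv.Perm (Fin p)) :
    Integrable (splitLLR s σa σ d d' k π) (splitLaw s σa σ d k π) := by
  unfold splitLaw splitLLR
  split_ifs
  · exact (integrable_spikeLLR σa σ d d').comp_snd _
  · exact integrable_zero _ _ _

theorem integral_splitLLR (s : ℕ) (σa σ : ℝ) (d d' : Fin m → ℝ) (k : Fin p)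
    (π : Equiv.Perm (Fin p)) :
    ∫ q, splitLLR s σa σ d d' k π q ∂splitLaw s σa σ d k π =
      if (π k : ℕ) < s then ∫ y, spikeLLR σa σ d d' y ∂spikeLaw σa σ d else 0 := by
  unfold splitLaw splitLLR
  split_ifs
  · rw [integral_fun_snd (spikeLLR σa σ d d')]
    simp
  · simp

/-- Only permutations with `π k < s` make column `k` active; they are a fraction `s/p` of all. -/
theorem integral_splitLLR_mixture_ge (hsp : s ≤ p) {σa σ : ℝ} (hσa : 0 < σa) (hσ : 0 < σ)
    {d d' : Fin m → ℝ} (hd : d ⬝ᵥ d = 1) (hd' : d' ⬝ᵥ d' = 1) (k : Fin p) :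
    -((s : ℝ) / p * ((σa ^ 2 / σ ^ 2) ^ 2 / 2 * ((d - d') ⬝ᵥ (d - d')))) ≤
      ∫ x, splitLLR s σa σ d d' k x.1 x.2
        ∂mixture (p ! : ℝ≥0∞)⁻¹ (splitLaw s σa σ d k) := by
  have hm : ∀ π, Measurable (splitLLR s σa σ d d' k π) := fun π =>
    (hasLogDensity_splitLaw s hσa hσ hd hd' k π).1
  rw [integral_mixture hm (integrable_splitLLR s σa σ d d' k)]
  simp only [integral_splitLLR]
  set I := ∫ y, spikeLLR σa σ d d' y ∂spikeLaw σa σ d with hI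
  have hp : 0 < (p : ℝ) := by exact_mod_cast k.pos
  have hf : (0 : ℝ) < p ! := by exact_mod_cast p.factorial_pos
  have h1 := sum_perm_apply (fun i : Fin p => if (i : ℕ) < s then I else 0) k
  rw [sum_ite_val_lt hsp] at h1
  have h2 : ((p ! : ℝ≥0∞)⁻¹).toReal *
      ∑ π : Equiv.Perm (Fin p), (if (π k : ℕ) < s then I else 0) = (s : ℝ) / p * I := by
    rw [ENNReal.toReal_inv, ENNReal.toReal_natCast]
    field_simp
    linarith
  rw [h2, ← mul_neg]
  exact mul_le_mul_of_nonneg_left (integral_spikeLLR_ge hσa hσ hd hd') (by positivity)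

/-- Two point bound for the estimation of a functional of dictionaries that differ in one column. -/
theorem dataLaw_two_point_bound (N : ℕ) (hsp : s ≤ p) {σa σ : ℝ} (hσa : 0 < σa) (hσ : 0 < σ)
    {D D' : Matrix (Fin m) (Fin p) ℝ} (k : Fin p) (hd : Dᵀ k ⬝ᵥ Dᵀ k = 1)
    (hd' : D'ᵀ k ⬝ᵥ D'ᵀ k = 1) (hDD' : ∀ l, l ≠ k → Dᵀ l = D'ᵀ l)
    {f : (Fin N → Fin m → ℝ) → ℝ} (hf : Measurable f) (θ θ' : ℝ) :
    ENNReal.ofReal ((θ - θ') ^ 2 * ((1 - N * ((s : ℝ) / p * ((σa ^ 2 / σ ^ 2) ^ 2 / 2 *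
        ((Dᵀ k - D'ᵀ k) ⬝ᵥ (Dᵀ k - D'ᵀ k))))) / 2)) ≤
      ∫⁻ Y, ENNReal.ofReal ((f Y - θ) ^ 2) ∂dataLaw N s σa σ D +
        ∫⁻ Y, ENNReal.ofReal ((f Y - θ') ^ 2) ∂dataLaw N s σa σ D' := by
  set P := mixture (p ! : ℝ≥0∞)⁻¹ (splitLaw s σa σ (Dᵀ k) k)
  set Q := mixture (p ! : ℝ≥0∞)⁻¹ (splitLaw s σa σ (D'ᵀ k) k)
  have : IsProbabilityMeasure P := isProbabilityMeasure_mixture _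
  have : IsProbabilityMeasure Q := isProbabilityMeasure_mixture _
  set T := fun x : Equiv.Perm (Fin p) × ((Fin s → ℝ) × (Fin m → ℝ)) => recombine D k x.1 x.2
    with hT
  have hTm : Measurable T := measurable_recombine_mixture D k
  -- Column `k` is multiplied by the coefficient `0`, and the other columns agree, so both
  -- experiments pass through the same map `T`.
  have hT' : T = fun x => recombine D' k x.1 x.2 := by
    ext x i
    simp only [hT, recombine, Pi.add_apply, Matrix.mulVec, dotProduct]
    congr 1
    refine Finset.sum_congr rfl fun l _ => ?_
    by_cases hl : l = k
    · subst hl; simp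
    · have := congrFun (hDD' l hl) i
      simp only [Matrix.transpose_apply] at this
      rw [this]
  have hP : dataLaw N s σa σ D = (Measure.pi fun _ : Fin N => P).map fun w i => T (w i) := by
    rw [dataLaw, obsLaw_eq_map_mixture s σa σ D k]
    have : IsProbabilityMeasure (P.map T) := Measure.isProbabilityMeasure_map hTm.aemeasurable
    exact (Measure.pi_map_pi fun _ => hTm.aemeasurable).symm
  have hQ : dataLaw N s σa σ D' = (Measure.pi fun _ : Fin N => Q).map fun w i => T (w i) := by
    rw [dataLaw, obsLaw_eq_map_mixture s σa σ D' k, ← hT']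
    have : IsProbabilityMeasure (Q.map T) := Measure.isProbabilityMeasure_map hTm.aemeasurable
    exact (Measure.pi_map_pi fun _ => hTm.aemeasurable).symm
  have hTN : Measurable fun (w : Fin N → _) i => T (w i) :=
    measurable_pi_lambda _ fun i => hTm.comp (measurable_pi_apply i)
  have hld := HasLogDensity.mixture (p ! : ℝ≥0∞)⁻¹ (hasLogDensity_splitLaw s hσa hσ hd hd' k)
  have hint := integrable_mixture (c := (p ! : ℝ≥0∞)⁻¹)
    (ENNReal.inv_ne_top.2 (by exact_mod_cast p.factorial_ne_zero))
    (fun π => (hasLogDensity_splitLaw s hσa hσ hd hd' k π).1)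
    (integrable_splitLLR s σa σ (Dᵀ k) (D'ᵀ k) k)
  have hge := integral_splitLLR_mixture_ge hsp hσa hσ hd hd' k
  have hev : ∀ i : Fin N, MeasurePreserving (Function.eval i) (Measure.pi fun _ : Fin N => P) P :=
    fun i => measurePreserving_eval (fun _ : Fin N => P) i
  have hinti : ∀ i : Fin N, Integrable (fun w : Fin N → _ =>
      splitLLR s σa σ (Dᵀ k) (D'ᵀ k) k (w i).1 (w i).2) (Measure.pi fun _ : Fin N => P) :=
    fun i => (hev i).integrable_comp_of_integrable hint
  have hsq : ∀ c : ℝ, Measurable fun Y => ENNReal.ofReal ((f Y - c) ^ 2) := fun c => by fun_prop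
  rw [hP, hQ, lintegral_map (hsq θ) hTN, lintegral_map (hsq θ') hTN]
  refine two_point_bound (HasLogDensity.pi fun _ : Fin N => hld)
    (integrable_finsetSum _ fun i _ => hinti i) ?_ (hf.comp hTN) θ θ'
  change _ ≤ ∫ w : Fin N → _, ∑ i, splitLLR s σa σ (Dᵀ k) (D'ᵀ k) k (w i).1 (w i).2
    ∂(Measure.pi fun _ : Fin N => P)
  rw [integral_finsetSum _ fun i _ => hinti i]
  have hi : ∀ i : Fin N, ∫ w, splitLLR s σa σ (Dᵀ k) (D'ᵀ k) k (w i).1 (w i).2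
      ∂(Measure.pi fun _ : Fin N => P) = ∫ x, splitLLR s σa σ (Dᵀ k) (D'ᵀ k) k x.1 x.2 ∂P := by
    intro i
    conv_rhs => rw [← (hev i).map_eq]
    rw [integral_map (hev i).measurable.aemeasurable hld.1.aestronglyMeasurable]
  simp only [hi, Finset.sum_const, Finset.card_univ, Fintype.card_fin, nsmul_eq_mul]
  rw [← mul_neg]
  exact mul_le_mul_of_nonneg_left hge (Nat.cast_nonneg N)

/-! ### Norms by columns, and the signal-to-noise ratio. -/

theorem euclNorm_sq {n : ℕ} (v : Fin n → ℝ) : euclNorm v ^ 2 = v ⬝ᵥ v := by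
  rw [euclNorm, EuclideanSpace.real_norm_sq_eq]
  simp [dotProduct, pow_two]

theorem frobNorm_sq (A : Matrix (Fin m) (Fin p) ℝ) :
    frobNorm A ^ 2 = ∑ k, Aᵀ k ⬝ᵥ Aᵀ k := by
  have h : (A * Aᵀ).trace = ∑ k, Aᵀ k ⬝ᵥ Aᵀ k := by
    simp only [Matrix.trace, Matrix.diag_apply, Matrix.mul_apply, Matrix.transpose_apply,
      dotProduct]
    exact Finset.sum_comm
  rw [frobNorm, Real.sq_sqrt, h]
  rw [h]
  exact Finset.sum_nonneg fun k _ => Finset.sum_nonneg fun i _ => mul_self_nonneg _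

theorem mem_obliqueManifold_iff (D : Matrix (Fin m) (Fin p) ℝ) :
    D ∈ obliqueManifold m p ↔ ∀ k, Dᵀ k ⬝ᵥ Dᵀ k = 1 := Iff.rfl

theorem sum_mul_zeroPad (hsp : s ≤ p) (g : Fin p → ℝ) (z : Fin s → ℝ) :
    ∑ i, g i * zeroPad p z i = ∑ j, g (Fin.castLE hsp j) * z j := by
  obtain ⟨t, rfl⟩ := Nat.exists_eq_add_of_le hsp
  rw [Fin.sum_univ_add]
  simp only [zeroPad, Fin.val_castAdd, Fin.is_lt, dite_true, Fin.val_natAdd, mul_dite, mul_zero]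
  simp
  rfl

theorem mulVec_coeff_apply (hsp : s ≤ p) (D : Matrix (Fin m) (Fin p) ℝ)
    (π : Equiv.Perm (Fin p)) (z : Fin s → ℝ) (i : Fin m) :
    (D *ᵥ coeff π z) i = (fun j => D i (π.symm (Fin.castLE hsp j))) ⬝ᵥ z := by
  have := sum_mul_zeroPad hsp (fun l => D i (π.symm l)) z
  rw [← Equiv.sum_comp π] at this
  simp only [Equiv.symm_apply_apply] at this
  exact this

theorem integrable_mulVec_coeff (hsp : s ≤ p) (σa : ℝ) {D : Matrix (Fin m) (Fin p) ℝ}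
    (hD : D ∈ obliqueManifold m p) (π : Equiv.Perm (Fin p)) :
    Integrable (fun z : Fin s → ℝ => euclNorm (D *ᵥ coeff π z) ^ 2) (iidGaussian s σa) ∧
      ∫ z : Fin s → ℝ, euclNorm (D *ᵥ coeff π z) ^ 2 ∂iidGaussian s σa = s * σa ^ 2 := by
  have e : ∀ z : Fin s → ℝ, euclNorm (D *ᵥ coeff π z) ^ 2 =
      ∑ i, ((fun j => D i (π.symm (Fin.castLE hsp j))) ⬝ᵥ z) ^ 2 := by
    intro z
    rw [euclNorm_sq, dotProduct]
    simp only [mulVec_coeff_apply hsp, pow_two]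
  simp only [e]
  have hi := fun i : Fin m =>
    (memLp_dotProduct_iidGaussian σa fun j => D i (π.symm (Fin.castLE hsp j))).integrable_sq
  refine ⟨integrable_finsetSum _ fun i _ => hi i, ?_⟩
  rw [integral_finsetSum _ fun i _ => hi i]
  simp only [integral_sq_dotProduct_iidGaussian]
  rw [← Finset.mul_sum]
  simp only [dotProduct]
  rw [Finset.sum_comm]
  have h1 : ∀ j : Fin s, ∑ i, D i (π.symm (Fin.castLE hsp j)) * D i (π.symm (Fin.castLE hsp j))
      = 1 := fun j => (mem_obliqueManifold_iff D).1 hD (π.symm (Fin.castLE hsp j))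
  simp only [h1]
  simp [mul_comm]

/-- Every active unit column contributes `σₐ²` to the signal energy, so the ratio is the same for
all normalized dictionaries. -/
theorem SNR_eq (hsp : s ≤ p) (σa σ : ℝ) {D : Matrix (Fin m) (Fin p) ℝ}
    (hD : D ∈ obliqueManifold m p) : SNR s σa σ D = s * σa ^ 2 / (m * σ ^ 2) := by
  have hnum : ∫ x, euclNorm (D *ᵥ x) ^ 2 ∂coeffLaw p s σa = s * σa ^ 2 := by
    have hm : Measurable fun x : Fin p → ℝ => euclNorm (D *ᵥ x) ^ 2 := by
      simp only [euclNorm_sq, dotProduct, Matrix.mulVec]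
      fun_prop
    have hi := integrable_mulVec_coeff hsp σa hD
    simp only [coeffLaw, permMatrix_mulVec_zeroPad]
    rw [integral_smul_measure, integral_finsetSum_measure]
    · have h1 : ∀ π : Equiv.Perm (Fin p), ∫ x, euclNorm (D *ᵥ x) ^ 2
          ∂(iidGaussian s σa).map (fun z => coeff π z) = s * σa ^ 2 := by
        intro π
        rw [integral_map (measurable_coeff π).aemeasurable hm.aestronglyMeasurable, (hi π).2]
      have hf : (p ! : ℝ) ≠ 0 := by exact_mod_cast p.factorial_ne_zero
      simp only [h1, Finset.sum_const, Finset.card_univ, Fintype.card_perm, Fintype.card_fin,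
        nsmul_eq_mul, ENNReal.toReal_inv, ENNReal.toReal_natCast, smul_eq_mul]
      field_simp
    · intro π _
      rw [integrable_map_measure hm.aestronglyMeasurable (measurable_coeff π).aemeasurable]
      exact (hi π).1
  have hden : ∫ n, euclNorm n ^ 2 ∂iidGaussian m σ = m * σ ^ 2 := by
    simp only [euclNorm_sq, dotProduct, ← pow_two]
    rw [integral_finsetSum _ fun i _ => (memLp_apply_iidGaussian σ i).integrable_sq]
    simp [integral_sq_apply_iidGaussian]
  rw [SNR, hnum, hden]

/-! ### The cube of dictionaries and Assouad's lemma. -/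

/-- The last clause is Bessel's inequality, which bounds the sum of the coordinate errors by the
squared norm of a column error. -/
theorem exists_orthonormal_complement {q : ℕ} (d : Fin (q + 1) → ℝ) (hd : d ⬝ᵥ d = 1) :
    ∃ u : Fin q → Fin (q + 1) → ℝ, (∀ i j, u i ⬝ᵥ u j = if i = j then 1 else 0) ∧
      (∀ i, u i ⬝ᵥ d = 0) ∧ ∀ w, ∑ i, (u i ⬝ᵥ w) ^ 2 ≤ w ⬝ᵥ w := by
  have inner_eq : ∀ x y : EuclideanSpace ℝ (Fin (q + 1)),
      inner ℝ x y = x.ofLp ⬝ᵥ y.ofLp := by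
    intro x y
    rw [EuclideanSpace.inner_eq_star_dotProduct, dotProduct_comm]
    simp
  set v : EuclideanSpace ℝ (Fin (q + 1)) := WithLp.toLp 2 d with hv
  have hv0 : v ≠ 0 := by
    intro h
    have h1 := inner_eq v v
    rw [h, inner_zero_left, ← h] at h1
    simp only [hv, hd] at h1
    exact zero_ne_one h1
  have : Fact (Module.finrank ℝ (EuclideanSpace ℝ (Fin (q + 1))) = q + 1) := ⟨by simp⟩
  set B := OrthonormalBasis.fromOrthogonalSpanSingleton (𝕜 := ℝ) q hv0
  set U : Fin q → EuclideanSpace ℝ (Fin (q + 1)) := fun i => (B i : _) with hU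
  have hUo : Orthonormal ℝ U :=
    B.orthonormal.comp_linearIsometry (Submodule.subtypeₗᵢ _)
  refine ⟨fun i => (U i).ofLp, fun i j => ?_, fun i => ?_, fun w => ?_⟩
  · rw [← inner_eq, orthonormal_iff_ite.1 hUo i j]
  · have h := (Submodule.mem_orthogonal_singleton_iff_inner_left (𝕜 := ℝ)).1 (B i).2
    rw [← h]
    exact (inner_eq (U i) v).symm
  · have h := hUo.sum_inner_products_le (s := Finset.univ) (WithLp.toLp 2 w)
    rw [← real_inner_self_eq_norm_sq, inner_eq] at h
    simpa only [inner_eq, Real.norm_eq_abs, sq_abs] using h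

section Columns

variable {n q : ℕ} {u : Fin q → Fin n → ℝ} {d : Fin n → ℝ}

theorem dotProduct_smul_add_sum (hu : ∀ i j, u i ⬝ᵥ u j = if i = j then 1 else 0)
    (hd : ∀ i, u i ⬝ᵥ d = 0) (c b : ℝ) (ε : Fin q → ℝ) (j : Fin q) :
    u j ⬝ᵥ (c • d + b • ∑ i, ε i • u i) = b * ε j := by
  rw [dotProduct_add, dotProduct_smul, hd, dotProduct_smul, dotProduct_sum]
  simp [dotProduct_smul, hu]

theorem smul_add_sum_dotProduct_self (hu : ∀ i j, u i ⬝ᵥ u j = if i = j then 1 else 0)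
    (hd : ∀ i, u i ⬝ᵥ d = 0) (hdd : d ⬝ᵥ d = 1) (c b : ℝ) {ε : Fin q → ℝ}
    (hε : ∀ i, ε i ^ 2 = 1) :
    (c • d + b • ∑ i, ε i • u i) ⬝ᵥ (c • d + b • ∑ i, ε i • u i) = c ^ 2 + q * b ^ 2 := by
  have hd' : ∀ i, d ⬝ᵥ u i = 0 := fun i => by rw [dotProduct_comm, hd]
  have h1 : d ⬝ᵥ (c • d + b • ∑ i, ε i • u i) = c := by
    rw [dotProduct_add, dotProduct_smul, hdd, dotProduct_smul, dotProduct_sum]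
    simp [dotProduct_smul, hd']
  rw [add_dotProduct, smul_dotProduct, smul_dotProduct, h1, sum_dotProduct]
  simp only [smul_dotProduct, dotProduct_smul_add_sum hu hd, smul_eq_mul]
  have : ∀ i, ε i * (b * ε i) = b := fun i => by linear_combination b * hε i
  simp only [this]
  simp
  ring

end Columns

/-- The sign `±1` encoded by a Boolean. -/
def boolSign (b : Bool) : ℝ := if b then 1 else -1

theorem boolSign_sq (b : Bool) : boolSign b ^ 2 = 1 := by cases b <;> simp [boolSign]

theorem boolSign_not (b : Bool) : boolSign (!b) = -boolSign b := by cases b <;> simp [boolSign]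

/-- **Assouad's lemma**, combinatorial part. -/
theorem card_mul_le_of_flip {J : Type*} [Fintype J] [DecidableEq J] {R : J → (J → Bool) → ℝ≥0∞}
    {M : (J → Bool) → ℝ≥0∞} {S c : ℝ≥0∞} (hR : ∀ τ, ∑ j, R j τ ≤ M τ) (hM : ∀ τ, M τ ≤ S)
    (hc : ∀ j τ, c ≤ R j τ + R j (Function.update τ j (!τ j))) :
    Fintype.card J * c ≤ 2 * S := by
  -- Flipping a bit is a bijection of the cube, so summing `hc` over the cube counts each `R j τ`
  -- twice.
  have hflip : ∀ j, ∑ τ, R j (Function.update τ j (!τ j)) = ∑ τ, R j τ := by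
    intro j
    have hinv : Function.Involutive fun τ : J → Bool => Function.update τ j (!τ j) := by
      intro τ; simp
    exact Fintype.sum_equiv hinv.toPerm _ _ fun τ => rfl
  have h1 : ∀ j, (Fintype.card (J → Bool) : ℝ≥0∞) * c ≤ 2 * ∑ τ, R j τ := by
    intro j
    calc (Fintype.card (J → Bool) : ℝ≥0∞) * c = ∑ _τ : J → Bool, c := by simp
      _ ≤ ∑ τ, (R j τ + R j (Function.update τ j (!τ j))) :=
          Finset.sum_le_sum fun τ _ => hc j τ
      _ = 2 * ∑ τ, R j τ := by rw [Finset.sum_add_distrib, hflip, two_mul]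
  have h2 : (Fintype.card (J → Bool) : ℝ≥0∞) * (Fintype.card J * c) ≤
      Fintype.card (J → Bool) * (2 * S) := by
    calc (Fintype.card (J → Bool) : ℝ≥0∞) * (Fintype.card J * c)
        = ∑ _j : J, (Fintype.card (J → Bool) : ℝ≥0∞) * c := by
          rw [Finset.sum_const, Finset.card_univ, nsmul_eq_mul]; ring
      _ ≤ ∑ j, 2 * ∑ τ, R j τ := Finset.sum_le_sum fun j _ => h1 j
      _ = 2 * ∑ τ, ∑ j, R j τ := by rw [← Finset.mul_sum, Finset.sum_comm]
      _ ≤ 2 * ∑ _τ : J → Bool, S := by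
          gcongr with τ _
          exact (hR τ).trans (hM τ)
      _ = Fintype.card (J → Bool) * (2 * S) := by
          rw [Finset.sum_const, Finset.card_univ, nsmul_eq_mul]; ring
  exact (ENNReal.mul_le_mul_iff_right (by exact_mod_cast Fintype.card_ne_zero)
    (ENNReal.natCast_ne_top _)).1 h2

/-- The dictionaries with columns `c d_k + b ∑ᵢ ± uₖᵢ`, with signs encoded by `τ`. -/
noncomputable def cubeDict {q : ℕ} (D₀ : Matrix (Fin m) (Fin p) ℝ) (u : Fin p → Fin q → Fin m → ℝ)
    (c b : ℝ) (τ : Fin p × Fin q → Bool) : Matrix (Fin m) (Fin p) ℝ :=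
  Matrix.of fun i k => (c • D₀ᵀ k + b • ∑ j, boolSign (τ (k, j)) • u k j) i

theorem cubeDict_transpose {q : ℕ} (D₀ : Matrix (Fin m) (Fin p) ℝ)
    (u : Fin p → Fin q → Fin m → ℝ) (c b : ℝ) (τ : Fin p × Fin q → Bool) (k : Fin p) :
    (cubeDict D₀ u c b τ)ᵀ k = c • D₀ᵀ k + b • ∑ j, boolSign (τ (k, j)) • u k j := rfl

theorem cubeDict_update_sub {q : ℕ} (D₀ : Matrix (Fin m) (Fin p) ℝ)
    (u : Fin p → Fin q → Fin m → ℝ) (c b : ℝ) (τ : Fin p × Fin q → Bool) (k : Fin p)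
    (j : Fin q) :
    (cubeDict D₀ u c b τ)ᵀ k -
      (cubeDict D₀ u c b (Function.update τ (k, j) (!τ (k, j))))ᵀ k =
      (2 * b * boolSign (τ (k, j))) • u k j := by
  rw [cubeDict_transpose, cubeDict_transpose, add_sub_add_left_eq_sub, ← smul_sub,
    ← Finset.sum_sub_distrib, Finset.sum_eq_single j]
  · rw [Function.update_self, boolSign_not, ← sub_smul, smul_smul]
    congr 1
    ring
  · intro i _ hi
    rw [Function.update_of_ne (by simp [hi]), sub_self]
  · simp

theorem cubeDict_update_transpose_of_ne {q : ℕ} (D₀ : Matrix (Fin m) (Fin p) ℝ)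
    (u : Fin p → Fin q → Fin m → ℝ) (c b : ℝ) (τ : Fin p × Fin q → Bool) {k l : Fin p}
    (hl : l ≠ k) (j : Fin q) (t : Bool) :
    (cubeDict D₀ u c b τ)ᵀ l = (cubeDict D₀ u c b (Function.update τ (k, j) t))ᵀ l := by
  rw [cubeDict_transpose, cubeDict_transpose]
  congr 2
  refine Finset.sum_congr rfl fun i _ => ?_
  rw [Function.update_of_ne (by simp [hl])]

/-- Lower bound on the minimax risk for every admissible squared radius `A` of the perturbation
of a single column. -/
theorem minimaxRisk_ge {q p s : ℕ} (N : ℕ) (hq : 0 < q) (hsp : s ≤ p) {σ σa : ℝ}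
    (hσ : 0 < σ) (hσa : 0 < σa) {r : ℝ} (hr0 : 0 < r) (hp : 0 < p)
    {D₀ : Matrix (Fin (q + 1)) (Fin p) ℝ} (hD₀ : D₀ ∈ obliqueManifold (q + 1) p)
    {A : ℝ} (hA0 : 0 ≤ A) (hA1 : A ≤ 1) (hAr : 4 * p * A ≤ r ^ 2)
    (hAN : 4 * (N * s * (σa ^ 2 / σ ^ 2) ^ 2 * A) ≤ p * q) :
    ENNReal.ofReal (p * A / 2) ≤ minimaxRisk N s σa σ D₀ r := by
  have hq' : (0 : ℝ) < q := by exact_mod_cast hq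
  have hp' : (0 : ℝ) < p := by exact_mod_cast hp
  have hd : ∀ k, D₀ᵀ k ⬝ᵥ D₀ᵀ k = 1 := (mem_obliqueManifold_iff D₀).1 hD₀
  choose u hu hud hub using fun k => exists_orthonormal_complement (D₀ᵀ k) (hd k)
  set α := √(1 - A) with hα
  have hα2 : α ^ 2 = 1 - A := Real.sq_sqrt (by linarith)
  have hα1 : 1 - A ≤ α := by
    have h0 : 0 ≤ α := Real.sqrt_nonneg _
    have h1 : α ≤ 1 := Real.sqrt_le_one.2 (by linarith)
    nlinarith
  set b := √(A / q) with hb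
  have hb2 : b ^ 2 = A / q := Real.sq_sqrt (by positivity)
  have hqb : (q : ℝ) * b ^ 2 = A := by rw [hb2]; field_simp
  set E := cubeDict D₀ u α b with hE
  have hEcol : ∀ τ k, (E τ)ᵀ k ⬝ᵥ (E τ)ᵀ k = 1 := by
    intro τ k
    rw [hE, cubeDict_transpose, smul_add_sum_dotProduct_self (hu k) (hud k) (hd k) _ _
      fun i => boolSign_sq _, hα2, hqb]
    ring
  have hEmem : ∀ τ, E τ ∈ neighborhood D₀ r := by
    intro τ
    refine ⟨hEcol τ, lt_of_pow_lt_pow_left₀ 2 hr0.le ?_⟩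
    have hcol : ∀ k, (E τ - D₀)ᵀ k ⬝ᵥ (E τ - D₀)ᵀ k = (α - 1) ^ 2 + A := by
      intro k
      have : (E τ - D₀)ᵀ k = (α - 1) • D₀ᵀ k + b • ∑ j, boolSign (τ (k, j)) • u k j := by
        change (E τ)ᵀ k - D₀ᵀ k = _
        rw [hE, cubeDict_transpose, sub_smul, one_smul]
        abel
      rw [this, smul_add_sum_dotProduct_self (hu k) (hud k) (hd k) _ _
        fun i => boolSign_sq _, hqb]
    rw [frobNorm_sq]
    simp only [hcol, Finset.sum_const, Finset.card_univ, Fintype.card_fin, nsmul_eq_mul]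
    -- The left side equals `2 - 2α`, and `α ≥ 1 - A`. The squared distance to `D₀` is then at most
    -- `2pA ≤ r²/2`, strictly inside the ball.
    have h2 : (α - 1) ^ 2 + A ≤ 2 * A := by nlinarith
    have h3 : (p : ℝ) * ((α - 1) ^ 2 + A) ≤ p * (2 * A) := by gcongr
    nlinarith [pow_pos hr0 2]
  refine le_iInf fun est => ?_
  set S := ⨆ D ∈ neighborhood D₀ r, mse N s σa σ est.1 D with hS
  set R : Fin p × Fin q → (Fin p × Fin q → Bool) → ℝ≥0∞ := fun j τ =>
    ∫⁻ Y, ENNReal.ofReal ((u j.1 j.2 ⬝ᵥ (est.1 Y)ᵀ j.1 - b * boolSign (τ j)) ^ 2)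
      ∂dataLaw N s σa σ (E τ) with hRdef
  have hmeas : ∀ j : Fin p × Fin q, Measurable fun Y => u j.1 j.2 ⬝ᵥ (est.1 Y)ᵀ j.1 := by
    intro j
    simp only [dotProduct, Matrix.transpose_apply]
    exact Finset.measurable_sum _ fun i _ => (est.2 i j.1).const_mul _
  have hR : ∀ τ, ∑ j, R j τ ≤ mse N s σa σ est.1 (E τ) := by
    intro τ
    simp only [hRdef]
    rw [← lintegral_finsetSum _ fun j _ =>
      (((hmeas j).sub_const _).pow_const 2).ennreal_ofReal]
    refine lintegral_mono fun Y => ?_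
    rw [← ENNReal.ofReal_sum_of_nonneg fun j _ => sq_nonneg _]
    refine ENNReal.ofReal_le_ofReal ?_
    rw [frobNorm_sq, Fintype.sum_prod_type]
    refine Finset.sum_le_sum fun k _ => le_trans (le_of_eq ?_) (hub k _)
    refine Finset.sum_congr rfl fun i _ => ?_
    have : (est.1 Y - E τ)ᵀ k = (est.1 Y)ᵀ k - (E τ)ᵀ k := rfl
    rw [this, dotProduct_sub, hE, cubeDict_transpose,
      dotProduct_smul_add_sum (hu k) (hud k)]
  have hM : ∀ τ, mse N s σa σ est.1 (E τ) ≤ S := fun τ =>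
    le_iSup₂ (f := fun D (_ : D ∈ neighborhood D₀ r) => mse N s σa σ est.1 D) (E τ) (hEmem τ)
  have hc : ∀ j τ, ENNReal.ofReal (b ^ 2) ≤ R j τ + R j (Function.update τ j (!τ j)) := by
    rintro ⟨k, i⟩ τ
    have h := dataLaw_two_point_bound N hsp hσa hσ k (hEcol τ k)
      (hEcol (Function.update τ (k, i) (!τ (k, i))) k)
      (fun l hl => cubeDict_update_transpose_of_ne D₀ u α b τ hl i _) (hmeas (k, i))
      (b * boolSign (τ (k, i)))
      (b * boolSign (Function.update τ (k, i) (!τ (k, i)) (k, i)))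
    refine le_trans (ENNReal.ofReal_le_ofReal ?_) h
    rw [hE, cubeDict_update_sub, smul_dotProduct, dotProduct_smul, hu, if_pos rfl,
      Function.update_self, boolSign_not]
    have hs2 := boolSign_sq (τ (k, i))
    set ε := boolSign (τ (k, i))
    have e1 : (b * ε - b * -ε) ^ 2 = 4 * b ^ 2 := by linear_combination 4 * b ^ 2 * hs2
    have e2 : (2 * b * ε) • (2 * b * ε) • (1 : ℝ) = 4 * b ^ 2 := by
      simp only [smul_eq_mul, mul_one]
      linear_combination 4 * b ^ 2 * hs2
    rw [e1, e2]
    -- By `hAN` the divergence is at most `1/2`; the two targets are `2b` apart, so the two point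
    -- bound gives at least `4b² · (1/2)/2 = b²`.
    have e3 : (N : ℝ) * ((s : ℝ) / p * ((σa ^ 2 / σ ^ 2) ^ 2 / 2 * (4 * b ^ 2))) ≤ 1 / 2 := by
      have : (N : ℝ) * ((s : ℝ) / p * ((σa ^ 2 / σ ^ 2) ^ 2 / 2 * (4 * b ^ 2))) =
          2 * (N * s * (σa ^ 2 / σ ^ 2) ^ 2 * A) / (p * q) := by
        rw [hb2]; field_simp; ring
      rw [this, div_le_iff₀ (by positivity)]
      linarith
    nlinarith [sq_nonneg b]
  -- This reads `p q b² ≤ 2S`, and `q b² = A`.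
  have hfin := card_mul_le_of_flip hR hM hc
  rw [Fintype.card_prod, Fintype.card_fin, Fintype.card_fin, ← ENNReal.ofReal_natCast,
    ← ENNReal.ofReal_mul (by positivity)] at hfin
  have e : p * A / 2 = (((p * q : ℕ) : ℝ) * b ^ 2) / 2 := by
    push_cast
    rw [mul_assoc, hqb]
  rw [e, ENNReal.ofReal_div_of_pos two_pos, ENNReal.ofReal_ofNat]
  refine ENNReal.div_le_of_le_mul ?_
  rwa [mul_comm S]

end DictLearn

/-! ### Choice of the perturbation radius and comparison with the stated bound. -/

theorem theorem2 (m p s N : ℕ) (hmp : m ≤ p) (hs : 1 ≤ s) (hsp : s ≤ p) (hN : 1 ≤ N)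
    (hdim : 50 ≤ (p : ℝ) * ((m : ℝ) - 1))
    (σ σa : ℝ) (hσ : 0 < σ) (hσa : 0 < σa)
    (r : ℝ) (hr : r ≤ 2 * √(p : ℝ))
    (D₀ : Matrix (Fin m) (Fin p) ℝ) (hD₀ : D₀ ∈ DictLearn.obliqueManifold m p)
    (D : Matrix (Fin m) (Fin p) ℝ) (hD : D ∈ DictLearn.neighborhood D₀ r)
    (δ : ℝ) (hδ : δ ≤ 1 / 2) (hRIP : DictLearn.RIP D s δ)
    (hSNR : DictLearn.SNR s σa σ D ≤ (1 / (9 * √80)) * ((m : ℝ) / (2 * (s : ℝ)))) :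
    ENNReal.ofReal ((1 / 12960) *
        min (r ^ 2 / (s : ℝ))
          ((p : ℝ) / (DictLearn.SNR s σa σ D ^ 2 * (N : ℝ) * (m : ℝ) ^ 2) *
            ((p : ℝ) * ((m : ℝ) - 1) / 10 - 1)))
      ≤ DictLearn.minimaxRisk N s σa σ D₀ r := by
  have hr0 : 0 < r := lt_of_le_of_lt (Real.sqrt_nonneg _) hD.2
  have hp : 0 < p := by omega
  have hp' : (0 : ℝ) < p := by exact_mod_cast hp
  -- In dimension one the orthogonal complement of a column is trivial and the cube has no
  -- directions; `hdim` excludes this.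
  have hm1 : 1 < m := by
    by_contra hcon
    have : (m : ℝ) ≤ 1 := by exact_mod_cast not_lt.1 hcon
    nlinarith
  obtain ⟨q, rfl⟩ : ∃ q, m = q + 1 := ⟨m - 1, by omega⟩
  have hq : 0 < q := by omega
  have hq' : (0 : ℝ) < q := by exact_mod_cast hq
  have hs' : (1 : ℝ) ≤ s := by exact_mod_cast hs
  have hN' : (1 : ℝ) ≤ N := by exact_mod_cast hN
  rw [DictLearn.SNR_eq hsp σa σ hD.1]
  set ρ := σa ^ 2 / σ ^ 2 with hρ
  have hρ0 : 0 < ρ := by positivity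
  -- This is the largest `A` allowed by `hAr` and `hAN`. The constraint `A ≤ 1` then follows from `r
  -- ≤ 2√p`.
  set A := min (r ^ 2 / (4 * p)) (p * q / (4 * (N * s * ρ ^ 2))) with hA
  have hr2 : r ^ 2 ≤ 4 * p := by
    calc r ^ 2 ≤ (2 * √(p : ℝ)) ^ 2 := by gcongr
      _ = 4 * (p : ℝ) := by rw [mul_pow, Real.sq_sqrt hp'.le]; norm_num
  have hA0 : 0 ≤ A := le_min (by positivity) (by positivity)
  have hAr : 4 * p * A ≤ r ^ 2 := by
    have := min_le_left (r ^ 2 / (4 * p)) (p * q / (4 * (N * s * ρ ^ 2)))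
    rw [← hA, le_div_iff₀ (by positivity)] at this
    linarith
  have hA1 : A ≤ 1 := by
    have : 4 * (p : ℝ) * A ≤ 4 * p * 1 := by linarith
    exact le_of_mul_le_mul_left this (by positivity)
  have hAN : 4 * (N * s * ρ ^ 2 * A) ≤ p * q := by
    have := min_le_right (r ^ 2 / (4 * p)) (p * q / (4 * (N * s * ρ ^ 2)))
    rw [← hA, le_div_iff₀ (by positivity)] at this
    linarith
  refine le_trans (ENNReal.ofReal_le_ofReal ?_)
    (DictLearn.minimaxRisk_ge N hq hsp hσ hσa hr0 hp hD₀ hA0 hA1 hAr hAN)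
  -- The ratio times `m` is `s ρ`, so `m` cancels from the prefactor.
  have hfac : (p : ℝ) / ((s * σa ^ 2 / (((q + 1 : ℕ) : ℝ) * σ ^ 2)) ^ 2 * N *
      ((q + 1 : ℕ) : ℝ) ^ 2) * (p * (((q + 1 : ℕ) : ℝ) - 1) / 10 - 1) =
      p / (s ^ 2 * ρ ^ 2 * N) * (p * q / 10 - 1) := by
    have : ((q + 1 : ℕ) : ℝ) ≠ 0 := by positivity
    have e : (s * σa ^ 2 / (((q + 1 : ℕ) : ℝ) * σ ^ 2)) ^ 2 * N * ((q + 1 : ℕ) : ℝ) ^ 2 =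
        s ^ 2 * ρ ^ 2 * N := by
      rw [hρ]; field_simp
    rw [e]
    push_cast
    ring
  rw [hfac]
  have hcase : p * A / 2 = min (r ^ 2 / 8) (p * (p * q) / (8 * (N * s * ρ ^ 2))) := by
    rw [hA, mul_min_of_nonneg _ _ hp'.le, ← min_div_div_right (by norm_num)]
    congr 1
    · field_simp; norm_num
    · field_simp; norm_num
  rw [hcase]
  -- Both terms obtained dominate the stated ones: no division by `s` in the first, `s` in place of
  -- `s²` in the second, and `1/8` in place of `1/12960`.
  refine le_min ?_ ?_
  · calc 1 / 12960 * min (r ^ 2 / (s : ℝ)) _ ≤ 1 / 12960 * (r ^ 2 / (s : ℝ)) := by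
          gcongr; exact min_le_left _ _
      _ ≤ 1 / 12960 * r ^ 2 := by gcongr; exact div_le_self (sq_nonneg _) hs'
      _ ≤ r ^ 2 / 8 := by linarith [pow_pos hr0 2]
  · have h1 : (p : ℝ) / (s ^ 2 * ρ ^ 2 * N) * (p * q / 10 - 1) ≤
        p * (p * q) / (N * s * ρ ^ 2) := by
      calc (p : ℝ) / (s ^ 2 * ρ ^ 2 * N) * (p * q / 10 - 1)
          ≤ (p : ℝ) / (s ^ 2 * ρ ^ 2 * N) * (p * q) := by
            gcongr
            nlinarith [mul_pos hp' hq']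
        _ = p * (p * q) / (s ^ 2 * ρ ^ 2 * N) := by ring
        _ ≤ p * (p * q) / (N * s * ρ ^ 2) := by
            refine div_le_div_of_nonneg_left (by positivity) (by positivity) ?_
            have : (s : ℝ) ≤ s ^ 2 := by nlinarith
            calc N * s * ρ ^ 2 = s * ρ ^ 2 * N := by ring
              _ ≤ s ^ 2 * ρ ^ 2 * N := by gcongr
    have h0 : (0 : ℝ) ≤ p * (p * q) / (N * s * ρ ^ 2) := by positivity
    calc 1 / 12960 * min (r ^ 2 / (s : ℝ)) (p / (s ^ 2 * ρ ^ 2 * N) * (p * q / 10 - 1))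
        ≤ 1 / 12960 * (p * (p * q) / (N * s * ρ ^ 2)) := by
          gcongr; exact (min_le_right _ _).trans h1
      _ ≤ 1 / 8 * (p * (p * q) / (N * s * ρ ^ 2)) := by gcongr; norm_num
      _ = p * (p * q) / (8 * (N * s * ρ ^ 2)) := by ring
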